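/- Let $M$ be a compact connected smooth manifold without boundary, of finite dimension, endowed with a $C^\infty$ Riemannian metric; let $d$ be the Riemannian distance and $\|\cdot\|_x$ the norm on $T_xM$ and the dual norm on $T_x^*M$. Let $H:T^*M\to\mathbb R$ be a continuous function such that $p\mapsto H(x,p)$ is convex on $T_x^*M$ for every $x\in M$, and such that $H(x,p)/\|p\|_x\to+\infty$ as $\|p\|_x\to+\infty$, uniformly in $x\in M$. Let $L:TM\to\mathbb R$ be the associated Lagrangian, $$L(x,v)=\sup_{p\in T_x^*M}\bigl(p(v)-H(x,p)\bigr).$$ For $\lambda>0$ and $x\in M$ put $$u_\lambda(x)=\inf_\gamma\int_{-\infty}^0 e^{\lambda s}L(\gamma(s),\dot\gamma(s))\,ds,$$ where the infimum is over all absolutely continuous curves $\gamma:(-\infty,0]\to M$ with $\gamma(0)=x$, and the integral takes values in $\mathbb R\cup\{+\infty\}$. For a continuous $u:M\to\mathbb R$ and $y\in M$, let $D^+u(y)$ (respectively $D^-u(y)$) be the set of the differentials $d_y\phi$ of the functions $\phi$ of class $C^1$ near $y$ such that $u-\phi$ has a local maximum (respectively minimum) at $y$. A continuous function $u$ is a viscosity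 solution of $$\lambda u(x)+H(x,d_xu)=0\quad\text{in } M$$ if, for every $x\in M$, $\lambda u(x)+H(x,p)\le 0$ for every $p\in D^+u(x)$ and $\lambda u(x)+H(x,p)\ge 0$ for every $p\in D^-u(x)$. Theorem. For every $\lambda>0$, the function $u_\lambda$ is real valued and continuous, and it is the unique continuous viscosity solution of $\lambda u+H(x,d_xu)=0$ in $M$. -/

import Mathlib

open Set MeasureTheory
open scoped Manifold ContDiff Topology ENNReal Bundle

noncomputable section

namespace DiscountedHJ

/-- The cotangent space `T_x^* M`. Once the tangent bundle carries a Riemannian metric, the norm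
on this space is the norm dual to the Riemannian norm on `T_x M`. -/
abbrev Cotangent {m : ℕ} {M : Type*} [TopologicalSpace M]
    [ChartedSpace (EuclideanSpace ℝ (Fin m)) M] (x : M) : Type :=
  TangentSpace (𝓡 m) x →L[ℝ] ℝ

/-- A Hamiltonian `H(x, p)`, `x ∈ M`, `p ∈ T_x^* M`, is continuous as a function on the total
space `T^* M` of the cotangent bundle (the bundle of homomorphisms from the tangent bundle to the
trivial line bundle, with its vector bundle topology). -/
def IsContinuousHamiltonian {m : ℕ} {M : Type*} [TopologicalSpace M]
    [ChartedSpace (EuclideanSpace ℝ (Fin m)) M] [IsManifold (𝓡 m) ∞ M]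
    (H : ∀ x : M, Cotangent (m := m) x → ℝ) : Prop :=
  Continuous fun q : Bundle.TotalSpace (EuclideanSpace ℝ (Fin m) →L[ℝ] ℝ)
    (fun x : M => TangentSpace (𝓡 m) x →L[ℝ] Bundle.Trivial M ℝ x) => H q.proj q.snd

/-- Convexity in the momentum (condition (H1)). -/
def IsConvexHamiltonian {m : ℕ} {M : Type*} [TopologicalSpace M]
    [ChartedSpace (EuclideanSpace ℝ (Fin m)) M]
    (H : ∀ x : M, Cotangent (m := m) x → ℝ) : Prop :=
  ∀ x : M, ConvexOn ℝ univ (H x)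

/-- Superlinearity: `H(x, p) / ‖p‖_x → +∞` as `‖p‖_x → +∞`, uniformly in `x`. -/
def IsSuperlinearHamiltonian {m : ℕ} {M : Type*} [TopologicalSpace M]
    [ChartedSpace (EuclideanSpace ℝ (Fin m)) M]
    [Bundle.RiemannianBundle (fun x : M => TangentSpace (𝓡 m) x)]
    (H : ∀ x : M, Cotangent (m := m) x → ℝ) : Prop :=
  ∀ A : ℝ, ∃ R : ℝ, ∀ (x : M) (p : Cotangent (m := m) x), R < ‖p‖ → A ≤ H x p / ‖p‖

/-- The Lagrangian associated with `H` by the Fenchel transform. The supremum is finite as soon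
as `H` is continuous and superlinear. -/
def lagrangian {m : ℕ} {M : Type*} [TopologicalSpace M]
    [ChartedSpace (EuclideanSpace ℝ (Fin m)) M]
    (H : ∀ x : M, Cotangent (m := m) x → ℝ) (x : M) (v : TangentSpace (𝓡 m) x) : ℝ :=
  ⨆ p : Cotangent (m := m) x, (p v - H x p)

/-- Absolute continuity of a curve on a closed interval `J`, bounded or not: for every `ε > 0`
there is `δ > 0` such that, for every countable family of pairwise disjoint intervals
`(a n, b n)` in `J` (intervals may be empty, so finite families are included) of total length
less than `δ`, the sum of the distances between the values at the end points is less than `ε`. -/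
def IsAbsolutelyContinuousCurve {X : Type*} [PseudoEMetricSpace X] (γ : ℝ → X) (J : Set ℝ) :
    Prop :=
  ∀ ε : ℝ≥0∞, 0 < ε → ∃ δ : ℝ≥0∞, 0 < δ ∧ ∀ a b : ℕ → ℝ,
    (∀ n, a n ≤ b n ∧ a n ∈ J ∧ b n ∈ J) →
    Pairwise (fun i j => Disjoint (Ioo (a i) (b i)) (Ioo (a j) (b j))) →
    ∑' n, ENNReal.ofReal (b n - a n) < δ →
    ∑' n, edist (γ (a n)) (γ (b n)) < ε

/-- The velocity of a curve in `M`. -/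
def velocity {m : ℕ} {M : Type*} [TopologicalSpace M]
    [ChartedSpace (EuclideanSpace ℝ (Fin m)) M] (γ : ℝ → M) (s : ℝ) :
    TangentSpace (𝓡 m) (γ s) :=
  mfderiv 𝓘(ℝ, ℝ) (𝓡 m) γ s (1 : ℝ)

/-- The integrand `e^{λ s} L(γ(s), γ'(s))`. -/
def discountedIntegrand {m : ℕ} {M : Type*} [TopologicalSpace M]
    [ChartedSpace (EuclideanSpace ℝ (Fin m)) M]
    (H : ∀ x : M, Cotangent (m := m) x → ℝ) (lam : ℝ) (γ : ℝ → M) (s : ℝ) : ℝ :=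
  Real.exp (lam * s) * lagrangian H (γ s) (velocity γ s)

/-- The discounted action `∫_{-∞}^0 e^{λ s} L(γ(s), γ'(s)) ds`, as the Lebesgue integral with
values in the extended reals: integral of the positive part minus integral of the negative part.
The negative part is integrable when `L` is bounded below and `λ > 0`, so that the action is then
well defined with values in `ℝ ∪ {+∞}`. -/
def discountedAction {m : ℕ} {M : Type*} [TopologicalSpace M]
    [ChartedSpace (EuclideanSpace ℝ (Fin m)) M]
    (H : ∀ x : M, Cotangent (m := m) x → ℝ) (lam : ℝ) (γ : ℝ → M) : EReal :=
  ((∫⁻ s in Iic (0 : ℝ), ENNReal.ofReal (discountedIntegrand H lam γ s) : ℝ≥0∞) : EReal) -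
    ((∫⁻ s in Iic (0 : ℝ), ENNReal.ofReal (-discountedIntegrand H lam γ s) : ℝ≥0∞) : EReal)

/-- The discounted value function `u_λ(x)`: the infimum of the discounted action over all
absolutely continuous curves `γ : ]-∞, 0] → M` with `γ(0) = x`. (Curves are represented by
functions on `ℝ`, whose values on `]0, +∞[` play no role.) -/
def discountedValue {m : ℕ} {M : Type*} [PseudoEMetricSpace M]
    [ChartedSpace (EuclideanSpace ℝ (Fin m)) M]
    (H : ∀ x : M, Cotangent (m := m) x → ℝ) (lam : ℝ) (x : M) : EReal :=
  ⨅ γ ∈ {γ : ℝ → M | IsAbsolutelyContinuousCurve γ (Iic 0) ∧ γ 0 = x}, discountedAction H lam γ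

/-- The set `D⁺u(y)` of superdifferentials of `u` at `y`: the differentials at `y` of the
functions `φ`, of class `C¹` near `y`, such that `u - φ` has a local maximum at `y`. -/
def superdifferential {m : ℕ} {M : Type*} [TopologicalSpace M]
    [ChartedSpace (EuclideanSpace ℝ (Fin m)) M] (u : M → ℝ) (y : M) :
    Set (Cotangent (m := m) y) :=
  {p | ∃ φ : M → ℝ, ContMDiffAt (𝓡 m) 𝓘(ℝ, ℝ) 1 φ y ∧ IsLocalMax (fun z => u z - φ z) y ∧
    mvfderiv (𝓡 m) φ y = p}

/-- The set `D⁻u(y)` of subdifferentials of `u` at `y`: the differentials at `y` of the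
functions `φ`, of class `C¹` near `y`, such that `u - φ` has a local minimum at `y`. -/
def subdifferential {m : ℕ} {M : Type*} [TopologicalSpace M]
    [ChartedSpace (EuclideanSpace ℝ (Fin m)) M] (u : M → ℝ) (y : M) :
    Set (Cotangent (m := m) y) :=
  {p | ∃ φ : M → ℝ, ContMDiffAt (𝓡 m) 𝓘(ℝ, ℝ) 1 φ y ∧ IsLocalMin (fun z => u z - φ z) y ∧
    mvfderiv (𝓡 m) φ y = p}

/-- Continuous viscosity subsolutions of `G(u(x), x, d_x u) = 0` in `M`. -/
def IsViscositySubsolution {m : ℕ} {M : Type*} [TopologicalSpace M]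
    [ChartedSpace (EuclideanSpace ℝ (Fin m)) M]
    (G : ℝ → ∀ x : M, Cotangent (m := m) x → ℝ) (u : M → ℝ) : Prop :=
  Continuous u ∧ ∀ x : M, ∀ p ∈ superdifferential u x, G (u x) x p ≤ 0

/-- Continuous viscosity supersolutions of `G(u(x), x, d_x u) = 0` in `M`. -/
def IsViscositySupersolution {m : ℕ} {M : Type*} [TopologicalSpace M]
    [ChartedSpace (EuclideanSpace ℝ (Fin m)) M]
    (G : ℝ → ∀ x : M, Cotangent (m := m) x → ℝ) (u : M → ℝ) : Prop :=
  Continuous u ∧ ∀ x : M, ∀ p ∈ subdifferential u x, 0 ≤ G (u x) x p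

/-- Continuous viscosity solutions of `G(u(x), x, d_x u) = 0` in `M`. -/
def IsViscositySolution {m : ℕ} {M : Type*} [TopologicalSpace M]
    [ChartedSpace (EuclideanSpace ℝ (Fin m)) M]
    (G : ℝ → ∀ x : M, Cotangent (m := m) x → ℝ) (u : M → ℝ) : Prop :=
  IsViscositySubsolution G u ∧ IsViscositySupersolution G u

/-- The left-hand side `λ u + H(x, p)` of the discounted equation. -/
def discountedOperator {m : ℕ} {M : Type*} [TopologicalSpace M]
    [ChartedSpace (EuclideanSpace ℝ (Fin m)) M]
    (H : ∀ x : M, Cotangent (m := m) x → ℝ) (lam : ℝ) :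
    ℝ → ∀ x : M, Cotangent (m := m) x → ℝ :=
  fun r x p => lam * r + H x p

end DiscountedHJ

end

/-! Existence rests on dynamic programming: for t ≥ 0, u(x) is the infimum of e^{-λt} u(γ(-t)) plus
the action on [-t, 0]. Two one-sided forms suffice and no minimising curve is needed:
`discountedValue_le_add` (append a Lipschitz curve to a near-optimal past) and `le_discountedAction`
(cut a competitor at time -t).

Testing the upper inequality on straight chart segments gives local Lipschitz bounds, hence
continuity. If u - φ has a local maximum at x, differentiating the same inequality at t = 0 gives
p(v) - L(x,v) ≤ -λu(x) for p = dφ. By convexity H(x,p) is approximated by such values p(v) - L(x,v)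
(`exists_lagrangian_le_sub`), so u is a subsolution.

If the supersolution inequality failed at x₀, the test function could be perturbed to a classical
subsolution ψ on a small ball, with ψ > u at the centre and ψ ≤ u on the boundary
(`exists_classical_subsolution`). Fenchel's inequality integrated along a curve up to its exit from
the ball (`sub_le_extendedIntegral`), together with `le_discountedAction`, makes every competitor
cost more than u(x₀) by a fixed amount, which is absurd.

Uniqueness is a comparison principle by doubling of variables in one chart around a maximum point of
u - w. Superlinearity bounds the momenta, so along a subsequence both viscosity inequalities pass to
the limit with the same covector p. The Hamiltonian terms cancel, leaving λ(u - w) ≤ 0 at the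
maximum. -/

namespace DiscountedHJ

/-! ### Tangent vectors and Hamiltonians read in a chart. -/

section Coordinates

variable {m : ℕ} {M : Type*} [TopologicalSpace M] [ChartedSpace (EuclideanSpace ℝ (Fin m)) M] [IsManifold (𝓡 m) ∞ M]

/-- The differential at `y` of the preferred chart at `x₀`, as a map into the model space. -/
noncomputable def toModel (x₀ y : M) : TangentSpace (𝓡 m) y →L[ℝ] EuclideanSpace ℝ (Fin m) :=
  (trivializationAt (EuclideanSpace ℝ (Fin m)) (TangentSpace (𝓡 m)) x₀).continuousLinearMapAt ℝ y

/-- The inverse of the differential at `y` of the preferred chart at `x₀`. -/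
noncomputable def ofModel (x₀ y : M) : EuclideanSpace ℝ (Fin m) →L[ℝ] TangentSpace (𝓡 m) y :=
  (trivializationAt (EuclideanSpace ℝ (Fin m)) (TangentSpace (𝓡 m)) x₀).symmL ℝ y

/-- A Hamiltonian read in the preferred chart at `x₀`. -/
noncomputable def localHamiltonian (H : ∀ x : M, Cotangent (m := m) x → ℝ) (x₀ : M) (z : EuclideanSpace ℝ (Fin m))
    (q : EuclideanSpace ℝ (Fin m) →L[ℝ] ℝ) : ℝ :=
  H ((extChartAt (𝓡 m) x₀).symm z) (q ∘L toModel x₀ ((extChartAt (𝓡 m) x₀).symm z))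

lemma ofModel_toModel {x₀ y : M} (hy : y ∈ (extChartAt (𝓡 m) x₀).source)
    (v : TangentSpace (𝓡 m) y) : ofModel x₀ y (toModel x₀ y v) = v := by
  have hy' : y ∈ (trivializationAt (EuclideanSpace ℝ (Fin m)) (TangentSpace (𝓡 m)) x₀).baseSet := by
    simpa using hy
  exact (trivializationAt (EuclideanSpace ℝ (Fin m)) (TangentSpace (𝓡 m)) x₀).symmL_continuousLinearMapAt hy' v

lemma toModel_ofModel {x₀ y : M} (hy : y ∈ (extChartAt (𝓡 m) x₀).source)
    (w : EuclideanSpace ℝ (Fin m)) : toModel x₀ y (ofModel x₀ y w) = w := by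
  have hy' : y ∈ (trivializationAt (EuclideanSpace ℝ (Fin m)) (TangentSpace (𝓡 m)) x₀).baseSet := by
    simpa using hy
  exact (trivializationAt (EuclideanSpace ℝ (Fin m)) (TangentSpace (𝓡 m)) x₀).continuousLinearMapAt_symmL hy' w

lemma toModel_eq_mfderiv {x₀ y : M} (hy : y ∈ (extChartAt (𝓡 m) x₀).source)
    (v : TangentSpace (𝓡 m) y) :
    toModel x₀ y v = mfderiv (𝓡 m) 𝓘(ℝ, EuclideanSpace ℝ (Fin m)) (extChartAt (𝓡 m) x₀) y v := by
  rw [toModel, TangentBundle.continuousLinearMapAt_trivializationAt (by simpa using hy)]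
  rfl

/-- The inverse trivialization of the cotangent bundle acts on fibres by precomposition with
`toModel`, so the chart expression is the continuous H composed with a continuous map into the total
space. Later limits of H are taken through this joint continuity. -/
lemma continuousOn_localHamiltonian {H : ∀ x : M, Cotangent (m := m) x → ℝ}
    (hcont : IsContinuousHamiltonian H) (x₀ : M) :
    ContinuousOn (fun zq : EuclideanSpace ℝ (Fin m) × (EuclideanSpace ℝ (Fin m) →L[ℝ] ℝ) => localHamiltonian H x₀ zq.1 zq.2)
      ((extChartAt (𝓡 m) x₀).target ×ˢ univ) := by
  let e := trivializationAt (EuclideanSpace ℝ (Fin m) →L[ℝ] ℝ)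
    (fun x : M => TangentSpace (𝓡 m) x →L[ℝ] Bundle.Trivial M ℝ x) x₀
  have h1 : ContinuousOn (fun zq : EuclideanSpace ℝ (Fin m) × (EuclideanSpace ℝ (Fin m) →L[ℝ] ℝ) => ((extChartAt (𝓡 m) x₀).symm zq.1, zq.2))
      ((extChartAt (𝓡 m) x₀).target ×ˢ univ) :=
    ((continuousOn_extChartAt_symm x₀).comp continuousOn_fst (fun _ h => h.1)).prodMk
      continuousOn_snd
  have hmaps : MapsTo (fun zq : EuclideanSpace ℝ (Fin m) × (EuclideanSpace ℝ (Fin m) →L[ℝ] ℝ) => ((extChartAt (𝓡 m) x₀).symm zq.1, zq.2))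
      ((extChartAt (𝓡 m) x₀).target ×ˢ univ) e.target := by
    rintro ⟨z, q⟩ ⟨hz, -⟩
    have := (extChartAt (𝓡 m) x₀).map_target hz
    simpa [e] using this
  have h2 := hcont.comp_continuousOn (e.continuousOn_symm.comp h1 hmaps)
  refine h2.congr ?_
  rintro ⟨z, q⟩ ⟨hz, -⟩
  have hy := (extChartAt (𝓡 m) x₀).map_target hz
  simp only [Function.comp_def, localHamiltonian]
  congr 1
  have hb : (extChartAt (𝓡 m) x₀).symm z ∈
      (trivializationAt (EuclideanSpace ℝ (Fin m)) (TangentSpace (𝓡 m)) x₀).baseSet ∩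
        (trivializationAt ℝ (Bundle.Trivial M ℝ) x₀).baseSet := by
    simpa using hy
  refine Eq.trans ?_ (Bundle.Pretrivialization.continuousLinearMap_symm_apply' (RingHom.id ℝ)
    (trivializationAt (EuclideanSpace ℝ (Fin m)) (TangentSpace (𝓡 m)) x₀)
    (trivializationAt ℝ (Bundle.Trivial M ℝ) x₀) hb q).symm
  ext v
  simp [toModel]
  rfl

end Coordinates
end DiscountedHJ

namespace DiscountedHJ

/-! ### Riemannian norms against chart norms. -/

section Norms

variable {m : ℕ} {M : Type*} [TopologicalSpace M] [ChartedSpace (EuclideanSpace ℝ (Fin m)) M] [IsManifold (𝓡 m) ∞ M]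
  [Bundle.RiemannianBundle (fun x : M => TangentSpace (𝓡 m) x)]
  [IsContinuousRiemannianBundle (EuclideanSpace ℝ (Fin m)) (fun x : M => TangentSpace (𝓡 m) x)]

lemma eventually_norm_toModel_le (x₀ : M) :
    ∃ C : ℝ, 0 < C ∧ ∀ᶠ y in 𝓝 x₀, ∀ v : TangentSpace (𝓡 m) y, ‖toModel x₀ y v‖ ≤ C * ‖v‖ := by
  obtain ⟨C, hC, h⟩ := eventually_norm_trivializationAt_lt (EuclideanSpace ℝ (Fin m))
    (fun x : M => TangentSpace (𝓡 m) x) x₀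
  refine ⟨C, hC, h.mono fun y hy v => ?_⟩
  exact ((ContinuousLinearMap.le_opNorm _ v).trans
    (mul_le_mul_of_nonneg_right hy.le (norm_nonneg v)) :)

lemma eventually_norm_ofModel_le (x₀ : M) :
    ∃ C : ℝ, 0 < C ∧ ∀ᶠ y in 𝓝 x₀, ∀ w : EuclideanSpace ℝ (Fin m), ‖ofModel x₀ y w‖ ≤ C * ‖w‖ := by
  obtain ⟨C, hC, h⟩ := eventually_norm_symmL_trivializationAt_lt (EuclideanSpace ℝ (Fin m))
    (fun x : M => TangentSpace (𝓡 m) x) x₀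
  refine ⟨C, hC, h.mono fun y hy v => ?_⟩
  exact ((ContinuousLinearMap.le_opNorm _ v).trans
    (mul_le_mul_of_nonneg_right hy.le (norm_nonneg v)) :)

/-- A Hamiltonian which is superlinear for the Riemannian norms is superlinear in the charts,
locally uniformly. -/
lemma IsSuperlinearHamiltonian.localHamiltonian {H : ∀ x : M, Cotangent (m := m) x → ℝ}
    (hsuper : IsSuperlinearHamiltonian H) (x₀ : M) (A : ℝ) :
    ∃ R : ℝ, 0 < R ∧ ∀ᶠ z in 𝓝 (extChartAt (𝓡 m) x₀ x₀), ∀ q : EuclideanSpace ℝ (Fin m) →L[ℝ] ℝ,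
      R ≤ ‖q‖ → A * ‖q‖ ≤ localHamiltonian H x₀ z q := by
  obtain ⟨C, hC, h⟩ := eventually_norm_ofModel_le (m := m) x₀
  obtain ⟨R, hR⟩ := hsuper (|A| * C)
  have hcont : ContinuousAt (extChartAt (𝓡 m) x₀).symm (extChartAt (𝓡 m) x₀ x₀) :=
    continuousAt_extChartAt_symm x₀
  have h' : ∀ᶠ z in 𝓝 (extChartAt (𝓡 m) x₀ x₀), ∀ w : EuclideanSpace ℝ (Fin m),
      ‖ofModel x₀ ((extChartAt (𝓡 m) x₀).symm z) w‖ ≤ C * ‖w‖ := by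
    rw [ContinuousAt, extChartAt_to_inv] at hcont
    exact hcont.eventually h
  -- Since ‖q‖ ≤ C‖p‖, a chart norm of at least C(|R| + 1) forces ‖p‖ > R. The slope |A|C requested
  -- from H pays for the same factor C.
  refine ⟨C * (|R| + 1), by positivity, ?_⟩
  filter_upwards [h', extChartAt_target_mem_nhds x₀] with z hz hzt q hq
  have hy := (extChartAt (𝓡 m) x₀).map_target hzt
  set y := (extChartAt (𝓡 m) x₀).symm z
  set p : Cotangent (m := m) y := q ∘L toModel x₀ y with hp
  have hqp : ‖q‖ ≤ C * ‖p‖ := by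
    refine ContinuousLinearMap.opNorm_le_bound _ (by positivity) fun w => ?_
    have h1 : q w = p (ofModel x₀ y w) := by simp [hp, toModel_ofModel hy]
    rw [h1]
    calc ‖p (ofModel x₀ y w)‖ ≤ ‖p‖ * ‖ofModel x₀ y w‖ := p.le_opNorm _
      _ ≤ ‖p‖ * (C * ‖w‖) := by gcongr; exact hz w
      _ = C * ‖p‖ * ‖w‖ := by ring
  have hpR : |R| + 1 ≤ ‖p‖ := le_of_mul_le_mul_left (hq.trans hqp) hC
  have hp0 : 0 < ‖p‖ := (by positivity : 0 < |R| + 1).trans_le hpR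
  have := hR y p (by linarith [le_abs_self R])
  rw [le_div_iff₀ hp0] at this
  calc A * ‖q‖ ≤ |A| * ‖q‖ := by gcongr; exact le_abs_self A
    _ ≤ |A| * (C * ‖p‖) := by gcongr
    _ = |A| * C * ‖p‖ := by ring
    _ ≤ _ := this

end Norms
end DiscountedHJ

namespace DiscountedHJ

/-! ### Velocities of curves in charts. -/

section Velocity

variable {m : ℕ} {M : Type*} [TopologicalSpace M] [ChartedSpace (EuclideanSpace ℝ (Fin m)) M] [IsManifold (𝓡 m) ∞ M]

lemma hasDerivAt_extChartAt_comp {x₀ : M} {γ : ℝ → M} {s : ℝ}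
    (hγ : MDifferentiableAt 𝓘(ℝ, ℝ) (𝓡 m) γ s) (hs : γ s ∈ (extChartAt (𝓡 m) x₀).source) :
    HasDerivAt (extChartAt (𝓡 m) x₀ ∘ γ) (toModel x₀ (γ s) (velocity γ s)) s := by
  have h1 : MDifferentiableAt (𝓡 m) 𝓘(ℝ, EuclideanSpace ℝ (Fin m)) (extChartAt (𝓡 m) x₀) (γ s) :=
    mdifferentiableAt_extChartAt (by simpa using hs)
  let D : ℝ →L[ℝ] EuclideanSpace ℝ (Fin m) := (mfderiv (𝓡 m) 𝓘(ℝ, EuclideanSpace ℝ (Fin m)) (extChartAt (𝓡 m) x₀) (γ s)).comp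
    (mfderiv 𝓘(ℝ, ℝ) (𝓡 m) γ s)
  have h2 : HasFDerivAt (extChartAt (𝓡 m) x₀ ∘ γ) D s :=
    (h1.hasMFDerivAt.comp s hγ.hasMFDerivAt).hasFDerivAt
  rw [toModel_eq_mfderiv hs]
  exact h2.hasDerivAt

lemma mdifferentiableAt_extChartAt_symm_comp {x₀ : M} {c : ℝ → EuclideanSpace ℝ (Fin m)} {s : ℝ}
    (hc : DifferentiableAt ℝ c s) (hs : c s ∈ (extChartAt (𝓡 m) x₀).target) :
    MDifferentiableAt 𝓘(ℝ, ℝ) (𝓡 m) ((extChartAt (𝓡 m) x₀).symm ∘ c) s := by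
  have h1 : MDifferentiableAt 𝓘(ℝ, EuclideanSpace ℝ (Fin m)) (𝓡 m) (extChartAt (𝓡 m) x₀).symm (c s) :=
    ((contMDiffOn_extChartAt_symm (n := 1) x₀).contMDiffAt
      ((isOpen_extChartAt_target x₀).mem_nhds hs)).mdifferentiableAt one_ne_zero
  exact h1.comp s hc.mdifferentiableAt

/-- Turns the intrinsic velocity into an ordinary derivative. Only the germ of γ at s matters, so
this serves curves built in a chart as well as given curves that stay in a chart near s. -/
lemma toModel_velocity_eq {x₀ : M} {γ : ℝ → M} {c : ℝ → EuclideanSpace ℝ (Fin m)} {w : EuclideanSpace ℝ (Fin m)} {s : ℝ}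
    (hc : HasDerivAt c w s) (hs : c s ∈ (extChartAt (𝓡 m) x₀).target)
    (hγ : γ =ᶠ[𝓝 s] (extChartAt (𝓡 m) x₀).symm ∘ c) :
    toModel x₀ (γ s) (velocity γ s) = w := by
  have h1 : MDifferentiableAt 𝓘(ℝ, ℝ) (𝓡 m) γ s :=
    (mdifferentiableAt_extChartAt_symm_comp hc.differentiableAt hs).congr_of_eventuallyEq hγ
  have h2 : γ s ∈ (extChartAt (𝓡 m) x₀).source := by
    rw [hγ.eq_of_nhds]
    exact (extChartAt (𝓡 m) x₀).map_target hs
  refine (hasDerivAt_extChartAt_comp h1 h2).unique (hc.congr_of_eventuallyEq ?_)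
  filter_upwards [hγ, hc.continuousAt.eventually
    ((isOpen_extChartAt_target x₀).mem_nhds hs)] with t ht htt
  simp only [Function.comp_apply, ht]
  exact (extChartAt (𝓡 m) x₀).right_inv htt

end Velocity

/-! ### Charts are locally bi-Lipschitz for the Riemannian distance. -/

section Metric

open scoped NNReal

variable {m : ℕ} {M : Type*} [MetricSpace M] [ChartedSpace (EuclideanSpace ℝ (Fin m)) M] [IsManifold (𝓡 m) ∞ M]
  [Bundle.RiemannianBundle (fun x : M => TangentSpace (𝓡 m) x)]
  [IsContinuousRiemannianBundle (EuclideanSpace ℝ (Fin m)) (fun x : M => TangentSpace (𝓡 m) x)]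
  [IsRiemannianManifold (𝓡 m) M]

/-- The inverse of a chart of a Riemannian manifold is locally Lipschitz. -/
lemma exists_lipschitzOnWith_extChartAt_symm (x₀ : M) :
    ∃ K : ℝ≥0, ∃ s ∈ 𝓝 (extChartAt (𝓡 m) x₀ x₀),
      LipschitzOnWith K (extChartAt (𝓡 m) x₀).symm s := by
  obtain ⟨C, hC, h⟩ := eventually_norm_ofModel_le (m := m) x₀
  lift C to ℝ≥0 using hC.le
  have hcont : ContinuousAt (extChartAt (𝓡 m) x₀).symm (extChartAt (𝓡 m) x₀ x₀) :=
    continuousAt_extChartAt_symm x₀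
  rw [ContinuousAt, extChartAt_to_inv] at hcont
  obtain ⟨r, hr, hball⟩ := Metric.mem_nhds_iff.1
    ((hcont.eventually h).and (extChartAt_target_mem_nhds (I := 𝓡 m) x₀))
  refine ⟨C, Metric.ball (extChartAt (𝓡 m) x₀ x₀) r, Metric.ball_mem_nhds _ hr, ?_⟩
  intro z hz z' hz'
  let c : ℝ → EuclideanSpace ℝ (Fin m) := AffineMap.lineMap z z'
  have hcb : ∀ t ∈ Icc (0 : ℝ) 1, c t ∈ Metric.ball (extChartAt (𝓡 m) x₀ x₀) r := fun t ht =>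
    (convex_ball _ _).segment_subset hz hz' (by
      rw [segment_eq_image_lineMap]; exact mem_image_of_mem _ ht)
  have hcd : ∀ t, HasDerivAt c (z' - z) t := fun t => AffineMap.hasDerivAt_lineMap
  have hcs : ContDiff ℝ 1 c := (ContinuousAffineMap.lineMap (R := ℝ) z z').contDiff
  have hγ : ContMDiffOn 𝓘(ℝ, ℝ) (𝓡 m) 1 ((extChartAt (𝓡 m) x₀).symm ∘ c) (Icc 0 1) :=
    (contMDiffOn_extChartAt_symm x₀).comp hcs.contMDiff.contMDiffOn
      (fun t ht => (hball (hcb t ht)).2)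
  rw [IsRiemannianManifold.out (I := 𝓡 m)]
  refine (Manifold.riemannianEDist_le_pathELength hγ (by simp [c]) (by simp [c])
    zero_le_one).trans ?_
  rw [Manifold.pathELength_eq_lintegral_mfderiv_Icc]
  calc ∫⁻ t in Icc (0 : ℝ) 1, ‖velocity (m := m) ((extChartAt (𝓡 m) x₀).symm ∘ c) t‖ₑ
      ≤ ∫⁻ t in Icc (0 : ℝ) 1, C * edist z z' := by
        refine setLIntegral_mono' measurableSet_Icc fun t ht => ?_
        have h1 := hball (hcb t ht)
        have h2 := toModel_velocity_eq (hcd t) h1.2 Filter.EventuallyEq.rfl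
        have h3 := h1.1 (z' - z)
        rw [← h2] at h3
        erw [ofModel_toModel ((extChartAt (𝓡 m) x₀).map_target h1.2)] at h3
        rw [h2] at h3
        rw [edist_comm, edist_eq_enorm_sub]
        simp only [← ofReal_norm, ← ENNReal.ofReal_coe_nnreal]
        rw [← ENNReal.ofReal_mul (by positivity)]
        exact ENNReal.ofReal_le_ofReal h3
    _ = C * edist z z' := by simp

/-- The charts of a Riemannian manifold are locally Lipschitz. -/
lemma exists_lipschitzOnWith_extChartAt (x₀ : M) :
    ∃ K : ℝ≥0, ∃ s ∈ 𝓝 x₀, LipschitzOnWith K (extChartAt (𝓡 m) x₀) s := by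
  obtain ⟨C, hC, h⟩ := eventually_norm_toModel_le (m := m) x₀
  lift C to ℝ≥0 using hC.le
  obtain ⟨ρ, hρ, hball⟩ := Metric.mem_nhds_iff.1
    (h.and (extChartAt_source_mem_nhds (I := 𝓡 m) x₀))
  -- Two points of this ball are at distance less than ρ/2, and a path of length less than ρ/2
  -- issued from one of them stays in the ball of radius ρ, where the bound on `toModel` holds.
  refine ⟨C, Metric.ball x₀ (ρ / 4), Metric.ball_mem_nhds _ (by positivity), ?_⟩
  intro a ha b hb
  have hab : edist a b < ENNReal.ofReal (ρ / 2) := by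
    rw [edist_dist]
    refine ENNReal.ofReal_lt_ofReal_iff'.2 ⟨?_, by positivity⟩
    have := dist_triangle_right a b x₀
    simp only [Metric.mem_ball] at ha hb
    linarith
  have hC0 : (C : ℝ≥0∞) ≠ 0 := by exact_mod_cast hC.ne'
  rw [← ENNReal.div_le_iff' hC0 ENNReal.coe_ne_top]
  refine le_of_forall_gt_imp_ge_of_dense fun r hr => ?_
  -- A larger r follows from the case r = ρ/2, which is admissible by `hab`.
  wlog hrρ : r ≤ ENNReal.ofReal (ρ / 2) generalizing r
  · exact (this _ hab le_rfl).trans (le_of_not_ge hrρ)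
  rw [ENNReal.div_le_iff' hC0 ENNReal.coe_ne_top]
  rw [IsRiemannianManifold.out (I := 𝓡 m)] at hr
  obtain ⟨γ, hγa, hγb, hγ, hlen, -⟩ :=
    Manifold.exists_lt_locally_constant_of_riemannianEDist_lt hr zero_lt_one
  have hmem : ∀ t ∈ Icc (0 : ℝ) 1, γ t ∈ Metric.ball x₀ ρ := by
    intro t ht
    have h1 : edist a (γ t) < ENNReal.ofReal (ρ / 2) := by
      rw [IsRiemannianManifold.out (I := 𝓡 m)]
      exact (((Manifold.riemannianEDist_le_pathELength hγ.contMDiffOn hγa rfl ht.1).trans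
        (Manifold.pathELength_mono le_rfl ht.2)).trans_lt hlen).trans_le hrρ
    rw [edist_dist, ENNReal.ofReal_lt_ofReal_iff (by positivity)] at h1
    simp only [Metric.mem_ball] at ha ⊢
    have := dist_triangle_left (γ t) x₀ a
    linarith
  have hsm : ContDiffOn ℝ 1 (extChartAt (𝓡 m) x₀ ∘ γ) (Icc 0 1) := by
    rw [← contMDiffOn_iff_contDiffOn]
    exact (contMDiffOn_extChartAt (x := x₀)).comp hγ.contMDiffOn fun t ht => by
      rw [← extChartAt_source (𝓡 m)]
      exact (hball (hmem t ht)).2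
  calc edist (extChartAt (𝓡 m) x₀ a) (extChartAt (𝓡 m) x₀ b)
      = ‖(extChartAt (𝓡 m) x₀ ∘ γ) 1 - (extChartAt (𝓡 m) x₀ ∘ γ) 0‖ₑ := by
        rw [edist_comm, edist_eq_enorm_sub, Function.comp_apply, Function.comp_apply, hγa, hγb]
    _ ≤ ∫⁻ t in Icc (0 : ℝ) 1, ‖deriv (extChartAt (𝓡 m) x₀ ∘ γ) t‖ₑ :=
        enorm_sub_le_lintegral_deriv_of_contDiffOn_Icc hsm zero_le_one
    _ ≤ ∫⁻ t in Icc (0 : ℝ) 1, C * ‖velocity (m := m) γ t‖ₑ := by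
        refine setLIntegral_mono' measurableSet_Icc fun t ht => ?_
        have h1 := hball (hmem t ht)
        rw [(hasDerivAt_extChartAt_comp (hγ.mdifferentiableAt one_ne_zero) h1.2).deriv]
        have h2 : ‖velocity (m := m) γ t‖ₑ = ENNReal.ofReal ‖velocity (m := m) γ t‖ := (ofReal_norm _).symm
        rw [h2, ← ofReal_norm, ← ENNReal.ofReal_coe_nnreal, ← ENNReal.ofReal_mul hC.le]
        exact ENNReal.ofReal_le_ofReal (h1.1 _)
    _ = C * Manifold.pathELength (𝓡 m) γ 0 1 := by
        rw [lintegral_const_mul' _ _ ENNReal.coe_ne_top,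
          Manifold.pathELength_eq_lintegral_mfderiv_Icc]
        rfl
    _ ≤ C * r := by gcongr

end Metric
end DiscountedHJ

namespace DiscountedHJ

/-! ### Test functions and viscosity differentials in charts. -/

section TestFunctions

variable {m : ℕ} {M : Type*} [TopologicalSpace M] [ChartedSpace (EuclideanSpace ℝ (Fin m)) M] [IsManifold (𝓡 m) ∞ M]

lemma mvfderiv_comp_extChartAt {x₀ y : M} (hy : y ∈ (extChartAt (𝓡 m) x₀).source) {ϕ : EuclideanSpace ℝ (Fin m) → ℝ}
    (hϕ : DifferentiableAt ℝ ϕ (extChartAt (𝓡 m) x₀ y)) :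
    mvfderiv (𝓡 m) (ϕ ∘ extChartAt (𝓡 m) x₀) y =
      fderiv ℝ ϕ (extChartAt (𝓡 m) x₀ y) ∘L toModel x₀ y := by
  have h1 : MDifferentiableAt (𝓡 m) 𝓘(ℝ, EuclideanSpace ℝ (Fin m)) (extChartAt (𝓡 m) x₀) y :=
    mdifferentiableAt_extChartAt (by simpa using hy)
  ext v
  rw [mvfderiv, mfderiv_comp y hϕ.mdifferentiableAt h1, mfderiv_eq_fderiv]
  simp only [ContinuousLinearMap.comp_apply, toModel_eq_mfderiv hy]
  rfl

omit [IsManifold (𝓡 m) ∞ M] in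
lemma eventually_extChartAt_symm_extChartAt {x₀ y : M}
    (hy : y ∈ (extChartAt (𝓡 m) x₀).source) :
    ∀ᶠ y' in 𝓝 y, (extChartAt (𝓡 m) x₀).symm (extChartAt (𝓡 m) x₀ y') = y' := by
  filter_upwards [(isOpen_extChartAt_source x₀).mem_nhds hy] with y' hy'
  exact (extChartAt (𝓡 m) x₀).left_inv hy'

lemma contMDiffAt_comp_extChartAt {x₀ : M} {z : EuclideanSpace ℝ (Fin m)} (hz : z ∈ (extChartAt (𝓡 m) x₀).target)
    {ϕ : EuclideanSpace ℝ (Fin m) → ℝ} (hϕ : ContDiffAt ℝ 1 ϕ z) :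
    ContMDiffAt (𝓡 m) 𝓘(ℝ, ℝ) 1 (ϕ ∘ extChartAt (𝓡 m) x₀) ((extChartAt (𝓡 m) x₀).symm z) := by
  have hy := (extChartAt (𝓡 m) x₀).map_target hz
  refine ContMDiffAt.comp (I' := 𝓘(ℝ, EuclideanSpace ℝ (Fin m))) _ ?_ (contMDiffAt_extChartAt' (by simpa using hy))
  rw [(extChartAt (𝓡 m) x₀).right_inv hz]
  exact hϕ.contMDiffAt

omit [IsManifold (𝓡 m) ∞ M] in
lemma tendsto_extChartAt_nhds {x₀ : M} {z : EuclideanSpace ℝ (Fin m)} (hz : z ∈ (extChartAt (𝓡 m) x₀).target) :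
    Filter.Tendsto (extChartAt (𝓡 m) x₀) (𝓝 ((extChartAt (𝓡 m) x₀).symm z)) (𝓝 z) := by
  have hy := (extChartAt (𝓡 m) x₀).map_target hz
  have := continuousAt_extChartAt' (I := 𝓡 m) hy
  rwa [ContinuousAt, (extChartAt (𝓡 m) x₀).right_inv hz] at this

/-- Superdifferentials computed in a chart. -/
lemma fderiv_comp_toModel_mem_superdifferential {x₀ : M} {z : EuclideanSpace ℝ (Fin m)}
    (hz : z ∈ (extChartAt (𝓡 m) x₀).target) {w : M → ℝ} {ϕ : EuclideanSpace ℝ (Fin m) → ℝ} (hϕ : ContDiffAt ℝ 1 ϕ z)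
    (hmax : IsLocalMax (fun z' => w ((extChartAt (𝓡 m) x₀).symm z') - ϕ z') z) :
    (fderiv ℝ ϕ z ∘L toModel x₀ ((extChartAt (𝓡 m) x₀).symm z)) ∈
      superdifferential w ((extChartAt (𝓡 m) x₀).symm z) := by
  have hy := (extChartAt (𝓡 m) x₀).map_target hz
  refine ⟨ϕ ∘ extChartAt (𝓡 m) x₀, contMDiffAt_comp_extChartAt hz hϕ, ?_, ?_⟩
  · filter_upwards [(tendsto_extChartAt_nhds hz).eventually hmax,
      eventually_extChartAt_symm_extChartAt hy] with y h1 h2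
    simpa only [Function.comp_apply, h2, (extChartAt (𝓡 m) x₀).right_inv hz] using h1
  · have h := mvfderiv_comp_extChartAt hy (ϕ := ϕ)
    rw [(extChartAt (𝓡 m) x₀).right_inv hz] at h
    exact h (hϕ.differentiableAt one_ne_zero)

/-- Subdifferentials computed in a chart. -/
lemma fderiv_comp_toModel_mem_subdifferential {x₀ : M} {z : EuclideanSpace ℝ (Fin m)}
    (hz : z ∈ (extChartAt (𝓡 m) x₀).target) {w : M → ℝ} {ϕ : EuclideanSpace ℝ (Fin m) → ℝ} (hϕ : ContDiffAt ℝ 1 ϕ z)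
    (hmin : IsLocalMin (fun z' => w ((extChartAt (𝓡 m) x₀).symm z') - ϕ z') z) :
    (fderiv ℝ ϕ z ∘L toModel x₀ ((extChartAt (𝓡 m) x₀).symm z)) ∈
      subdifferential w ((extChartAt (𝓡 m) x₀).symm z) := by
  have hy := (extChartAt (𝓡 m) x₀).map_target hz
  refine ⟨ϕ ∘ extChartAt (𝓡 m) x₀, contMDiffAt_comp_extChartAt hz hϕ, ?_, ?_⟩
  · filter_upwards [(tendsto_extChartAt_nhds hz).eventually hmin,
      eventually_extChartAt_symm_extChartAt hy] with y h1 h2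
    simpa only [Function.comp_apply, h2, (extChartAt (𝓡 m) x₀).right_inv hz] using h1
  · have h := mvfderiv_comp_extChartAt hy (ϕ := ϕ)
    rw [(extChartAt (𝓡 m) x₀).right_inv hz] at h
    exact h (hϕ.differentiableAt one_ne_zero)

/-- A `C¹` function read in a chart. -/
lemma contDiffAt_comp_extChartAt_symm {x₀ : M} {f : M → ℝ}
    (hf : ContMDiffAt (𝓡 m) 𝓘(ℝ, ℝ) 1 f x₀) :
    ContDiffAt ℝ 1 (f ∘ (extChartAt (𝓡 m) x₀).symm) (extChartAt (𝓡 m) x₀ x₀) ∧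
      mvfderiv (𝓡 m) f x₀ = fderiv ℝ (f ∘ (extChartAt (𝓡 m) x₀).symm)
        (extChartAt (𝓡 m) x₀ x₀) ∘L toModel x₀ x₀ := by
  have h1 : ContDiffAt ℝ 1 (f ∘ (extChartAt (𝓡 m) x₀).symm) (extChartAt (𝓡 m) x₀ x₀) := by
    rw [← contMDiffAt_iff_contDiffAt]
    refine ContMDiffAt.comp (I' := 𝓡 m) _ ?_ ((contMDiffOn_extChartAt_symm x₀).contMDiffAt
      (extChartAt_target_mem_nhds x₀))
    rwa [extChartAt_to_inv]
  refine ⟨h1, ?_⟩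
  rw [← mvfderiv_comp_extChartAt (mem_extChartAt_source x₀) (h1.differentiableAt one_ne_zero)]
  have h2 : f =ᶠ[𝓝 x₀] (f ∘ (extChartAt (𝓡 m) x₀).symm) ∘ extChartAt (𝓡 m) x₀ := by
    filter_upwards [eventually_extChartAt_symm_extChartAt (mem_extChartAt_source (I := 𝓡 m) x₀)]
      with y hy
    simp only [Function.comp_apply, hy]
  ext v
  simp only [mvfderiv, ContinuousLinearMap.comp_apply]
  rw [h2.mfderiv_eq]
  rfl

lemma exists_of_mem_superdifferential {x₀ : M} {w : M → ℝ} {p : Cotangent (m := m) x₀}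
    (hp : p ∈ superdifferential w x₀) : ∃ ϕ : EuclideanSpace ℝ (Fin m) → ℝ,
      ContDiffAt ℝ 1 ϕ (extChartAt (𝓡 m) x₀ x₀) ∧
      IsLocalMax (fun z => w ((extChartAt (𝓡 m) x₀).symm z) - ϕ z) (extChartAt (𝓡 m) x₀ x₀) ∧
      p = fderiv ℝ ϕ (extChartAt (𝓡 m) x₀ x₀) ∘L toModel x₀ x₀ := by
  obtain ⟨f, hf, hmax, rfl⟩ := hp
  obtain ⟨h1, h2⟩ := contDiffAt_comp_extChartAt_symm hf
  refine ⟨_, h1, ?_, h2⟩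
  have hc : ContinuousAt (extChartAt (𝓡 m) x₀).symm (extChartAt (𝓡 m) x₀ x₀) :=
    continuousAt_extChartAt_symm x₀
  rw [ContinuousAt, extChartAt_to_inv] at hc
  filter_upwards [hc.eventually hmax] with z hz
  simpa only [Function.comp_apply, extChartAt_to_inv] using hz

lemma exists_of_mem_subdifferential {x₀ : M} {w : M → ℝ} {p : Cotangent (m := m) x₀}
    (hp : p ∈ subdifferential w x₀) : ∃ ϕ : EuclideanSpace ℝ (Fin m) → ℝ,
      ContDiffAt ℝ 1 ϕ (extChartAt (𝓡 m) x₀ x₀) ∧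
      IsLocalMin (fun z => w ((extChartAt (𝓡 m) x₀).symm z) - ϕ z) (extChartAt (𝓡 m) x₀ x₀) ∧
      p = fderiv ℝ ϕ (extChartAt (𝓡 m) x₀ x₀) ∘L toModel x₀ x₀ := by
  obtain ⟨f, hf, hmax, rfl⟩ := hp
  obtain ⟨h1, h2⟩ := contDiffAt_comp_extChartAt_symm hf
  refine ⟨_, h1, ?_, h2⟩
  have hc : ContinuousAt (extChartAt (𝓡 m) x₀).symm (extChartAt (𝓡 m) x₀ x₀) :=
    continuousAt_extChartAt_symm x₀
  rw [ContinuousAt, extChartAt_to_inv] at hc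
  filter_upwards [hc.eventually hmax] with z hz
  simpa only [Function.comp_apply, extChartAt_to_inv] using hz

end TestFunctions
end DiscountedHJ

namespace DiscountedHJ

/-! ### Fenchel duality and local bounds on the Lagrangian. -/

section Fenchel

variable {m : ℕ} {M : Type*} [TopologicalSpace M] [ChartedSpace (EuclideanSpace ℝ (Fin m)) M] [IsManifold (𝓡 m) ∞ M]

lemma continuous_localHamiltonian_self {H : ∀ x : M, Cotangent (m := m) x → ℝ}
    (hcont : IsContinuousHamiltonian H) (x₀ : M) :
    Continuous (localHamiltonian H x₀ (extChartAt (𝓡 m) x₀ x₀)) := by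
  rw [← continuousOn_univ]
  exact (continuousOn_localHamiltonian hcont x₀).comp
    (continuousOn_const.prodMk continuousOn_id) fun q _ =>
      ⟨mem_extChartAt_target x₀, mem_univ _⟩

/-- A strict lower bound for the Hamiltonian on a ball of a fibre persists on nearby fibres. -/
lemma eventually_forall_lt_localHamiltonian {H : ∀ x : M, Cotangent (m := m) x → ℝ}
    (hcont : IsContinuousHamiltonian H) (x₀ : M) (R : ℝ) {f : (EuclideanSpace ℝ (Fin m) →L[ℝ] ℝ) → ℝ}
    (hf : Continuous f)
    (hlt : ∀ q ∈ Metric.closedBall (0 : EuclideanSpace ℝ (Fin m) →L[ℝ] ℝ) R,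
      f q < localHamiltonian H x₀ (extChartAt (𝓡 m) x₀ x₀) q) :
    ∀ᶠ z in 𝓝 (extChartAt (𝓡 m) x₀ x₀), ∀ q ∈ Metric.closedBall (0 : EuclideanSpace ℝ (Fin m) →L[ℝ] ℝ) R,
      f q < localHamiltonian H x₀ z q := by
  refine (isCompact_closedBall _ _).eventually_forall_of_forall_eventually fun q hq => ?_
  have h1 : ContinuousAt (fun zq : EuclideanSpace ℝ (Fin m) × (EuclideanSpace ℝ (Fin m) →L[ℝ] ℝ) => localHamiltonian H x₀ zq.1 zq.2)
      (extChartAt (𝓡 m) x₀ x₀, q) :=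
    (continuousOn_localHamiltonian hcont x₀).continuousAt
      (prod_mem_nhds (extChartAt_target_mem_nhds x₀) Filter.univ_mem)
  exact (hf.comp continuous_snd).continuousAt.eventually_lt h1 (hlt q hq)

/-- The Hamiltonian in a fibre, read through the linear map `toModel`. -/
lemma localHamiltonian_extChartAt {H : ∀ x : M, Cotangent (m := m) x → ℝ} {x₀ y : M}
    (hy : y ∈ (extChartAt (𝓡 m) x₀).source) (q : EuclideanSpace ℝ (Fin m) →L[ℝ] ℝ) :
    localHamiltonian H x₀ (extChartAt (𝓡 m) x₀ y) q = H y (q ∘L toModel x₀ y) := by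
  rw [localHamiltonian, (extChartAt (𝓡 m) x₀).left_inv hy]

/-- Every covector p at y is (p ∘ `ofModel`) ∘ `toModel`, so the supremum may be tested on the dual
of the model space. -/
lemma lagrangian_le {H : ∀ x : M, Cotangent (m := m) x → ℝ} {x₀ y : M}
    (hy : y ∈ (extChartAt (𝓡 m) x₀).source) (v : TangentSpace (𝓡 m) y) {K : ℝ}
    (hK : ∀ q : EuclideanSpace ℝ (Fin m) →L[ℝ] ℝ,
      q (toModel x₀ y v) - localHamiltonian H x₀ (extChartAt (𝓡 m) x₀ y) q ≤ K) :
    lagrangian H y v ≤ K := by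
  refine ciSup_le fun p => ?_
  have h := hK (p ∘L ofModel x₀ y)
  have h1 : (p ∘L ofModel x₀ y) ∘L toModel x₀ y = p := by
    ext w
    simp [ofModel_toModel hy]
  rw [localHamiltonian_extChartAt hy, h1] at h
  simpa [ofModel_toModel hy] using h

/-- Approximate subgradients of a convex Hamiltonian. -/
lemma exists_lagrangian_le_sub {H : ∀ x : M, Cotangent (m := m) x → ℝ}
    (hcont : IsContinuousHamiltonian H) (hconv : IsConvexHamiltonian H) (x : M)
    (p : Cotangent (m := m) x) {a : ℝ} (ha : a < H x p) :
    ∃ v : TangentSpace (𝓡 m) x, lagrangian H x v ≤ p v - a := by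
  have hx := mem_extChartAt_source (I := 𝓡 m) x
  have hc := continuous_localHamiltonian_self hcont x
  have hcv : ConvexOn ℝ univ (localHamiltonian H x (extChartAt (𝓡 m) x x)) := by
    refine ⟨convex_univ, fun q _ q' _ s t hs ht hst => ?_⟩
    simp only [localHamiltonian_extChartAt hx]
    refine le_trans (le_of_eq ?_) ((hconv x).2 (mem_univ (q ∘L toModel x x))
      (mem_univ (q' ∘L toModel x x)) hs ht hst)
    congr 1
  set q₀ := p ∘L ofModel x x
  have h1 : q₀ ∘L toModel x x = p := by
    ext u
    simp [q₀, ofModel_toModel hx]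
  have ha' : a < localHamiltonian H x (extChartAt (𝓡 m) x x) q₀ := by
    rwa [localHamiltonian_extChartAt hx, h1]
  -- Separation: a continuous convex function has an affine minorant l + c taking the value a < H at
  -- q₀. By finite-dimensional duality l is evaluation at a vector w, and the minorant says exactly
  -- that L(w) ≤ -c.
  obtain ⟨l, c, hlc, hla⟩ := hcv.exists_affine_le_of_lt (𝕜 := ℝ) (mem_univ q₀) ha' isClosed_univ
    (hc.lowerSemicontinuous.lowerSemicontinuousOn _)
  let e := InnerProductSpace.toDual ℝ (EuclideanSpace ℝ (Fin m))
  set w : EuclideanSpace ℝ (Fin m) := e.symm (l ∘L innerSL ℝ) with hw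
  have hl : ∀ q, l q = q w := by
    intro q
    obtain ⟨u, rfl⟩ := e.surjective q
    have h2 : inner ℝ w u = l (e u) := by
      rw [hw, InnerProductSpace.toDual_symm_apply]
      rfl
    rw [← h2, real_inner_comm]
    rfl
  refine ⟨ofModel x x w, ?_⟩
  have h2 : p (ofModel x x w) - a = -c := by
    have h3 : q₀ w + c = a := by simpa [hl] using hla
    have h4 : q₀ w = p (ofModel x x w) := rfl
    linarith
  rw [h2]
  refine lagrangian_le hx _ fun q => ?_
  rw [toModel_ofModel hx]
  have h3 : q w + c ≤ localHamiltonian H x (extChartAt (𝓡 m) x x) q := by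
    simpa [hl] using hlc ⟨q, mem_univ q⟩
  linarith

variable [Bundle.RiemannianBundle (fun x : M => TangentSpace (𝓡 m) x)]
  [IsContinuousRiemannianBundle (EuclideanSpace ℝ (Fin m)) (fun x : M => TangentSpace (𝓡 m) x)]

/-- Fenchel's inequality. -/
lemma sub_le_lagrangian {H : ∀ x : M, Cotangent (m := m) x → ℝ}
    (hcont : IsContinuousHamiltonian H) (hsuper : IsSuperlinearHamiltonian H) (x : M)
    (v : TangentSpace (𝓡 m) x) (p : Cotangent (m := m) x) :
    p v - H x p ≤ lagrangian H x v := by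
  -- A real supremum has a default value when the family is unbounded, so boundedness must be
  -- proved: slope ‖w‖ makes the terms nonpositive for large ‖q‖, and compactness handles the rest.
  refine le_ciSup (f := fun p : Cotangent (m := m) x => p v - H x p) ?_ p
  have hx := mem_extChartAt_source (I := 𝓡 m) x
  set w := toModel x x v with hw
  obtain ⟨R, hR, h⟩ := hsuper.localHamiltonian x ‖w‖
  have hc := continuous_localHamiltonian_self hcont x
  obtain ⟨K, hK⟩ := (isCompact_closedBall (0 : EuclideanSpace ℝ (Fin m) →L[ℝ] ℝ) R).exists_bound_of_continuousOn
    (f := fun q => q w - localHamiltonian H x (extChartAt (𝓡 m) x x) q)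
    (by fun_prop)
  refine ⟨max K 0, ?_⟩
  rintro _ ⟨p, rfl⟩
  have h1 : (p ∘L ofModel x x) ∘L toModel x x = p := by
    ext u
    simp [ofModel_toModel hx]
  have h2 : p v - H x p = (p ∘L ofModel x x) w -
      localHamiltonian H x (extChartAt (𝓡 m) x x) (p ∘L ofModel x x) := by
    rw [localHamiltonian_extChartAt hx, h1, hw]
    simp [ofModel_toModel hx]
  simp only [h2]
  set q := p ∘L ofModel x x
  rcases le_total ‖q‖ R with hq | hq
  · exact le_max_of_le_left ((le_abs_self _).trans (hK q (by simpa using hq)))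
  · have h3 := h.self_of_nhds q hq
    have h4 : q w ≤ ‖q‖ * ‖w‖ := (le_abs_self _).trans (q.le_opNorm w)
    exact le_max_of_le_right (by linarith)

lemma sub_localHamiltonian_le_lagrangian {H : ∀ x : M, Cotangent (m := m) x → ℝ}
    (hcont : IsContinuousHamiltonian H) (hsuper : IsSuperlinearHamiltonian H) {x₀ y : M}
    (hy : y ∈ (extChartAt (𝓡 m) x₀).source) (v : TangentSpace (𝓡 m) y) (q : EuclideanSpace ℝ (Fin m) →L[ℝ] ℝ) :
    q (toModel x₀ y v) - localHamiltonian H x₀ (extChartAt (𝓡 m) x₀ y) q ≤ lagrangian H y v := by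
  rw [localHamiltonian_extChartAt hy]
  exact sub_le_lagrangian hcont hsuper y v (q ∘L toModel x₀ y)

/-- The Lagrangian is upper semicontinuous along constant vectors in a chart. -/
lemma eventually_lagrangian_le_add {H : ∀ x : M, Cotangent (m := m) x → ℝ}
    (hcont : IsContinuousHamiltonian H) (hsuper : IsSuperlinearHamiltonian H) (x₀ : M)
    (v : TangentSpace (𝓡 m) x₀) {ε : ℝ} (hε : 0 < ε) :
    ∀ᶠ z in 𝓝 (extChartAt (𝓡 m) x₀ x₀), ∀ v' : TangentSpace (𝓡 m) ((extChartAt (𝓡 m) x₀).symm z),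
      toModel x₀ _ v' = toModel x₀ x₀ v → lagrangian H _ v' ≤ lagrangian H x₀ v + ε := by
  set w := toModel x₀ x₀ v with hw
  set K := lagrangian H x₀ v
  -- With this slope, q(w) - H ≤ -‖q‖, which is below K as soon as ‖q‖ ≥ |K|. Only a compact ball of
  -- covectors remains, where the strict Fenchel bound K + ε at x₀ persists nearby.
  obtain ⟨R, hR, h⟩ := hsuper.localHamiltonian x₀ (‖w‖ + 1)
  have h1 := eventually_forall_lt_localHamiltonian hcont x₀ (max R |K|)
    (f := fun q => q w - (K + ε)) (by fun_prop) fun q _ => by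
      have := sub_localHamiltonian_le_lagrangian hcont hsuper (mem_extChartAt_source x₀) v q
      linarith
  filter_upwards [h, h1, extChartAt_target_mem_nhds x₀] with z hz hz1 hzt v' hv'
  refine lagrangian_le ((extChartAt (𝓡 m) x₀).map_target hzt) v' fun q => ?_
  rw [hv', (extChartAt (𝓡 m) x₀).right_inv hzt]
  rcases le_total ‖q‖ (max R |K|) with hq | hq
  · linarith [hz1 q (by simpa using hq)]
  · have h3 := hz q ((le_max_left _ _).trans hq)
    have h4 : q w ≤ ‖q‖ * ‖w‖ := (le_abs_self _).trans (q.le_opNorm w)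
    have h5 := (le_max_right R |K|).trans hq
    linarith [neg_abs_le K]

/-- The Lagrangian is locally bounded above on the vectors of norm at most one in a chart. -/
lemma exists_eventually_lagrangian_le {H : ∀ x : M, Cotangent (m := m) x → ℝ}
    (hcont : IsContinuousHamiltonian H) (hsuper : IsSuperlinearHamiltonian H) (x₀ : M) :
    ∃ K : ℝ, ∀ᶠ z in 𝓝 (extChartAt (𝓡 m) x₀ x₀),
      ∀ v : TangentSpace (𝓡 m) ((extChartAt (𝓡 m) x₀).symm z),
        ‖toModel x₀ _ v‖ ≤ 1 → lagrangian H _ v ≤ K := by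
  obtain ⟨R, hR, h⟩ := hsuper.localHamiltonian x₀ 1
  obtain ⟨B, hB⟩ := (isCompact_closedBall (0 : EuclideanSpace ℝ (Fin m) →L[ℝ] ℝ) R).exists_bound_of_continuousOn
    (continuous_localHamiltonian_self hcont x₀).continuousOn
  have h1 := eventually_forall_lt_localHamiltonian hcont x₀ R
    (f := fun q => - B - 1) (by fun_prop) fun q hq => by
      linarith [neg_le_of_abs_le (hB q hq)]
  -- The value 0 covers ‖q‖ ≥ R, where H ≥ ‖q‖; the other value covers ‖q‖ ≤ R, where H > -B - 1.
  refine ⟨max 0 (R + B + 1), ?_⟩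
  filter_upwards [h, h1, extChartAt_target_mem_nhds x₀] with z hz hz1 hzt v hv
  refine lagrangian_le ((extChartAt (𝓡 m) x₀).map_target hzt) v fun q => ?_
  rw [(extChartAt (𝓡 m) x₀).right_inv hzt]
  have h4 : q (toModel x₀ _ v) ≤ ‖q‖ := by
    refine ((le_abs_self _).trans (q.le_opNorm _)).trans ?_
    exact mul_le_of_le_one_right (norm_nonneg q) hv
  rcases le_total ‖q‖ R with hq | hq
  · exact le_max_of_le_right (by linarith [hz1 q (by simpa using hq)])
  · exact le_max_of_le_left (by linarith [hz q hq])

/-- Taking p = 0 in Fenchel's inequality gives L(x,v) ≥ -H(x,0), and H(·,0) is continuous on a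
compact space. This bound keeps all actions away from -∞. -/
lemma exists_le_lagrangian [CompactSpace M] {H : ∀ x : M, Cotangent (m := m) x → ℝ}
    (hcont : IsContinuousHamiltonian H) (hsuper : IsSuperlinearHamiltonian H) :
    ∃ C : ℝ, ∀ (x : M) (v : TangentSpace (𝓡 m) x), -C ≤ lagrangian H x v := by
  have hc : Continuous fun x : M => H x 0 := by
    rw [continuous_iff_continuousAt]
    intro x₀
    have h1 : ContinuousAt (fun y => localHamiltonian H x₀ (extChartAt (𝓡 m) x₀ y) 0) x₀ := by
      refine ContinuousAt.comp (f := fun y : M => (extChartAt (𝓡 m) x₀ y, (0 : EuclideanSpace ℝ (Fin m) →L[ℝ] ℝ)))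
        (g := fun zq : EuclideanSpace ℝ (Fin m) × (EuclideanSpace ℝ (Fin m) →L[ℝ] ℝ) => localHamiltonian H x₀ zq.1 zq.2) ?_
        ((continuousAt_extChartAt x₀).prodMk continuousAt_const)
      exact (continuousOn_localHamiltonian hcont x₀).continuousAt
        (prod_mem_nhds (extChartAt_target_mem_nhds x₀) Filter.univ_mem)
    refine h1.congr ?_
    filter_upwards [extChartAt_source_mem_nhds (I := 𝓡 m) x₀] with y hy
    rw [localHamiltonian_extChartAt hy, ContinuousLinearMap.zero_comp]
  obtain ⟨C, hC⟩ := isCompact_univ.exists_bound_of_continuousOn hc.continuousOn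
  refine ⟨C, fun x v => ?_⟩
  have h1 := sub_le_lagrangian hcont hsuper x v 0
  have h2 := (le_abs_self _).trans (hC x (mem_univ _))
  have h3 : (0 : Cotangent (m := m) x) v = 0 := rfl
  linarith

end Fenchel
end DiscountedHJ

namespace DiscountedHJ

/-! ### Integrals with values in the extended reals. -/

section ExtendedIntegral

/-- The integral with values in the extended reals: integral of the positive part minus integral
of the negative part. -/
noncomputable def extendedIntegral (f : ℝ → ℝ) (S : Set ℝ) : EReal :=
  ((∫⁻ s in S, ENNReal.ofReal (f s) : ℝ≥0∞) : EReal) -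
    ((∫⁻ s in S, ENNReal.ofReal (-f s) : ℝ≥0∞) : EReal)

lemma extendedIntegral_mono {f g : ℝ → ℝ} {S : Set ℝ}
    (h : ∀ᵐ s ∂volume.restrict S, f s ≤ g s) : extendedIntegral f S ≤ extendedIntegral g S := by
  refine EReal.sub_le_sub ?_ ?_
  · exact EReal.coe_ennreal_le_coe_ennreal_iff.2
      (lintegral_mono_ae (h.mono fun s hs => ENNReal.ofReal_le_ofReal hs))
  · exact EReal.coe_ennreal_le_coe_ennreal_iff.2
      (lintegral_mono_ae (h.mono fun s hs => ENNReal.ofReal_le_ofReal (neg_le_neg hs)))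

lemma extendedIntegral_congr {f g : ℝ → ℝ} {S : Set ℝ}
    (h : ∀ᵐ s ∂volume.restrict S, f s = g s) : extendedIntegral f S = extendedIntegral g S :=
  le_antisymm (extendedIntegral_mono (h.mono fun _ hs => hs.le))
    (extendedIntegral_mono (h.mono fun _ hs => hs.ge))

lemma extendedIntegral_eq_integral {f : ℝ → ℝ} {S : Set ℝ} (hf : IntegrableOn f S) :
    extendedIntegral f S = ((∫ s in S, f s : ℝ) : EReal) := by
  have h1 : (∫⁻ s in S, ENNReal.ofReal (f s)) ≠ ⊤ := by
    refine ne_top_of_le_ne_top hf.2.ne (lintegral_mono fun s => ?_)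
    exact Real.ofReal_le_enorm (f s)
  have h2 : (∫⁻ s in S, ENNReal.ofReal (-f s)) ≠ ⊤ := by
    refine ne_top_of_le_ne_top hf.neg.2.ne (lintegral_mono fun s => ?_)
    exact Real.ofReal_le_enorm (-f s)
  rw [integral_eq_lintegral_pos_part_sub_lintegral_neg_part hf, extendedIntegral, EReal.coe_sub]
  lift (∫⁻ s in S, ENNReal.ofReal (f s)) to NNReal using h1 with a
  lift (∫⁻ s in S, ENNReal.ofReal (-f s)) to NNReal using h2 with b
  rfl

/-- Finiteness of the negative part excludes ∞ - ∞. Lower Lebesgue integrals add over disjoint sets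
without measurability of f, so nothing has to be known about the measurability of L along a curve.
-/
lemma extendedIntegral_union {f : ℝ → ℝ} {S T : Set ℝ} (hST : Disjoint S T)
    (hT : MeasurableSet T) (hf : (∫⁻ s in S ∪ T, ENNReal.ofReal (-f s)) ≠ ⊤) :
    extendedIntegral f (S ∪ T) = extendedIntegral f S + extendedIntegral f T := by
  have hN := lintegral_union (μ := volume) (f := fun s => ENNReal.ofReal (-f s)) hT hST
  have hP := lintegral_union (μ := volume) (f := fun s => ENNReal.ofReal (f s)) hT hST
  rw [hN] at hf
  simp only [extendedIntegral]
  rw [hN, hP]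
  generalize (∫⁻ s in S, ENNReal.ofReal (f s)) = a at *
  generalize (∫⁻ s in T, ENNReal.ofReal (f s)) = b at *
  generalize (∫⁻ s in S, ENNReal.ofReal (-f s)) = c at *
  generalize (∫⁻ s in T, ENNReal.ofReal (-f s)) = d at *
  rw [ENNReal.add_ne_top] at hf
  lift c to NNReal using hf.1
  lift d to NNReal using hf.2
  rw [EReal.coe_ennreal_add, EReal.coe_ennreal_add, sub_eq_add_neg, sub_eq_add_neg, sub_eq_add_neg,
    EReal.neg_add (Or.inl (by simp)) (Or.inl (by simp)), sub_eq_add_neg, add_add_add_comm]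

lemma extendedIntegral_comp_sub {f : ℝ → ℝ} (t : ℝ) :
    extendedIntegral (fun s => f (s + t)) (Iic (-t)) = extendedIntegral f (Iic 0) := by
  have h : ∀ g : ℝ → ℝ≥0∞, ∫⁻ s in Iic (-t), g (s + t) = ∫⁻ s in Iic 0, g s := by
    intro g
    have h1 := (measurePreserving_add_right volume t).setLIntegral_comp_preimage_emb
      (measurableEmbedding_addRight t) g (Iic 0)
    simpa [Set.preimage_add_const_Iic] using h1
  simp only [extendedIntegral]
  rw [h fun s => ENNReal.ofReal (f s), h fun s => ENNReal.ofReal (-f s)]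

lemma extendedIntegral_const_mul {f : ℝ → ℝ} {S : Set ℝ} {c : ℝ} (hc : 0 ≤ c) :
    extendedIntegral (fun s => c * f s) S = c * extendedIntegral f S := by
  have h : ∀ g : ℝ → ℝ, ((∫⁻ s in S, ENNReal.ofReal (c * g s) : ℝ≥0∞) : EReal) =
      c * ((∫⁻ s in S, ENNReal.ofReal (g s) : ℝ≥0∞) : EReal) := by
    intro g
    simp only [ENNReal.ofReal_mul hc]
    rw [lintegral_const_mul' _ _ ENNReal.ofReal_ne_top, EReal.coe_ennreal_mul,
      EReal.coe_ennreal_ofReal, max_eq_left hc]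
  simp only [extendedIntegral]
  rw [h f]
  have h2 := h fun s => -f s
  simp only [mul_neg] at h2
  rw [h2, sub_eq_add_neg, sub_eq_add_neg, EReal.left_distrib_of_nonneg_of_ne_top
    (EReal.coe_nonneg.2 hc) (EReal.coe_ne_top c), mul_neg]

end ExtendedIntegral

/-! ### Locality, time translation and splitting of the action. -/

section Action

variable {m : ℕ} {M : Type*} [TopologicalSpace M] [ChartedSpace (EuclideanSpace ℝ (Fin m)) M]

lemma discountedAction_eq (H : ∀ x : M, Cotangent (m := m) x → ℝ) (lam : ℝ) (γ : ℝ → M) :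
    discountedAction H lam γ = extendedIntegral (discountedIntegrand H lam γ) (Iic 0) := rfl

lemma discountedIntegrand_congr {H : ∀ x : M, Cotangent (m := m) x → ℝ} {lam : ℝ} {γ η : ℝ → M}
    {s : ℝ} (h : γ =ᶠ[𝓝 s] η) :
    discountedIntegrand H lam γ s = discountedIntegrand H lam η s := by
  have h1 : ∀ (y : M) (hy : y = η s) (v : TangentSpace (𝓡 m) y),
      HEq v (velocity (m := m) η s) →
      lagrangian H y v = lagrangian H (η s) (velocity η s) := by
    rintro _ rfl v hv
    rw [eq_of_heq hv]
  simp only [discountedIntegrand]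
  rw [h1 (γ s) h.eq_of_nhds]
  simp only [velocity]
  rw [h.mfderiv_eq]
  rfl

lemma discountedAction_congr {H : ∀ x : M, Cotangent (m := m) x → ℝ} {lam : ℝ} {γ η : ℝ → M}
    (h : EqOn γ η (Iic 0)) : discountedAction H lam γ = discountedAction H lam η := by
  rw [discountedAction_eq, discountedAction_eq]
  refine extendedIntegral_congr ?_
  -- At s = 0 the two-sided derivative sees the irrelevant values on positive times. That instant is
  -- negligible, and at s < 0 the germs coincide.
  rw [← restrict_Iio_eq_restrict_Iic]
  filter_upwards [self_mem_ae_restrict measurableSet_Iio] with s hs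
  exact discountedIntegrand_congr (Filter.eventually_of_mem (Iic_mem_nhds hs) h)

lemma velocity_comp_add (γ : ℝ → M) (t s : ℝ) :
    velocity (m := m) (fun s => γ (s + t)) s = velocity (m := m) γ (s + t) := by
  have hshift : ∀ a b : ℝ, MDifferentiableAt 𝓘(ℝ, ℝ) 𝓘(ℝ, ℝ) (fun s : ℝ => s + a) b := fun a b =>
    (differentiableAt_id.add_const a).mdifferentiableAt
  by_cases hγ : MDifferentiableAt 𝓘(ℝ, ℝ) (𝓡 m) γ (s + t)
  · have h1 := mfderiv_comp (I' := 𝓘(ℝ, ℝ)) (f := fun s : ℝ => s + t) (g := γ) s hγ (hshift t s)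
    have h2 : mfderiv 𝓘(ℝ, ℝ) 𝓘(ℝ, ℝ) (fun s : ℝ => s + t) s = ContinuousLinearMap.id ℝ ℝ := by
      rw [mfderiv_eq_fderiv, fderiv_add_const, fderiv_fun_id]
    have h3 := congrArg (fun D : TangentSpace 𝓘(ℝ, ℝ) s →L[ℝ] TangentSpace (𝓡 m) (γ (s + t)) =>
      D (1 : ℝ)) h1
    refine Eq.trans h3 ?_
    rw [h2]
    rfl
  -- Without differentiability both velocities take the default value 0.
  · have h1 : ¬ MDifferentiableAt 𝓘(ℝ, ℝ) (𝓡 m) (fun s => γ (s + t)) s := by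
      intro h
      apply hγ
      have h2 : MDifferentiableAt 𝓘(ℝ, ℝ) (𝓡 m) (fun s => γ (s + t)) (s + t + -t) := by
        simpa using h
      have h3 := h2.comp (s + t) (hshift (-t) (s + t))
      simpa [Function.comp_def] using h3
    simp only [velocity]
    rw [mfderiv_zero_of_not_mdifferentiableAt hγ, mfderiv_zero_of_not_mdifferentiableAt h1]
    rfl

lemma discountedIntegrand_eq_exp_mul (H : ∀ x : M, Cotangent (m := m) x → ℝ) (lam : ℝ)
    (γ : ℝ → M) (t s : ℝ) :
    discountedIntegrand H lam γ s =
      Real.exp (-(lam * t)) * discountedIntegrand H lam (fun s => γ (s - t)) (s + t) := by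
  have h1 : γ =ᶠ[𝓝 s] fun s => (fun s => γ (s - t)) (s + t) :=
    Filter.Eventually.of_forall fun s => by simp
  rw [discountedIntegrand_congr h1, discountedIntegrand, discountedIntegrand,
    velocity_comp_add (m := m) (fun s => γ (s - t)) t s,
    ← mul_assoc, ← Real.exp_add]
  congr 2
  ring

lemma lintegral_neg_discountedIntegrand_ne_top {H : ∀ x : M, Cotangent (m := m) x → ℝ} {C : ℝ}
    (hC : ∀ (x : M) (v : TangentSpace (𝓡 m) x), -C ≤ lagrangian H x v) {lam : ℝ} (hlam : 0 < lam)
    (γ : ℝ → M) :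
    (∫⁻ s in Iic 0, ENNReal.ofReal (-discountedIntegrand H lam γ s)) ≠ ⊤ := by
  have h1 : IntegrableOn (fun s => C * Real.exp (lam * s)) (Iic 0) :=
    (integrableOn_exp_mul_Iic hlam 0).const_mul C
  refine ne_top_of_le_ne_top h1.2.ne (lintegral_mono fun s => ?_)
  refine (ENNReal.ofReal_le_ofReal ?_).trans (Real.ofReal_le_enorm _)
  have := mul_le_mul_of_nonneg_left (hC (γ s) (velocity γ s)) (Real.exp_pos (lam * s)).le
  rw [discountedIntegrand]
  linarith

/-- The discounted action of a curve splits at a negative time. -/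
lemma discountedAction_eq_add {H : ∀ x : M, Cotangent (m := m) x → ℝ} {C : ℝ}
    (hC : ∀ (x : M) (v : TangentSpace (𝓡 m) x), -C ≤ lagrangian H x v) {lam : ℝ} (hlam : 0 < lam)
    (γ : ℝ → M) {t : ℝ} (ht : 0 ≤ t) :
    discountedAction H lam γ =
      (Real.exp (-(lam * t)) : EReal) * discountedAction H lam (fun s => γ (s - t)) +
        extendedIntegral (discountedIntegrand H lam γ) (Ioc (-t) 0) := by
  have h1 : Iic (-t) ∪ Ioc (-t) 0 = Iic 0 := Iic_union_Ioc_eq_Iic (by linarith)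
  have h2 := lintegral_neg_discountedIntegrand_ne_top hC hlam γ
  rw [← h1] at h2
  rw [discountedAction_eq, ← h1, extendedIntegral_union
    (Iic_disjoint_Ioc le_rfl) measurableSet_Ioc h2]
  congr 1
  rw [discountedAction_eq, ← extendedIntegral_const_mul (Real.exp_pos _).le,
    ← extendedIntegral_comp_sub t]
  exact extendedIntegral_congr (Filter.Eventually.of_forall fun s =>
    discountedIntegrand_eq_exp_mul H lam γ t s)

end Action
end DiscountedHJ

namespace DiscountedHJ

/-! ### Operations on absolutely continuous curves. -/

section AbsolutelyContinuousCurves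

open scoped NNReal

variable {X : Type*} [PseudoMetricSpace X]

lemma IsAbsolutelyContinuousCurve.mono {γ : ℝ → X} {J J' : Set ℝ}
    (h : IsAbsolutelyContinuousCurve γ J) (hJ : J' ⊆ J) : IsAbsolutelyContinuousCurve γ J' := by
  intro ε hε
  obtain ⟨δ, hδ, h⟩ := h ε hε
  exact ⟨δ, hδ, fun a b hab => h a b fun n => ⟨(hab n).1, hJ (hab n).2.1, hJ (hab n).2.2⟩⟩

lemma isAbsolutelyContinuousCurve_const (x : X) (J : Set ℝ) :
    IsAbsolutelyContinuousCurve (fun _ => x) J := by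
  intro ε hε
  exact ⟨1, zero_lt_one, fun a b _ _ _ => by simpa using hε⟩

lemma IsAbsolutelyContinuousCurve.congr {γ η : ℝ → X} {J : Set ℝ}
    (h : IsAbsolutelyContinuousCurve γ J) (heq : EqOn γ η J) :
    IsAbsolutelyContinuousCurve η J := by
  intro ε hε
  obtain ⟨δ, hδ, h⟩ := h ε hε
  refine ⟨δ, hδ, fun a b hab hdisj hsum => ?_⟩
  have := h a b hab hdisj hsum
  simpa only [fun n => heq (hab n).2.1, fun n => heq (hab n).2.2] using this

lemma IsAbsolutelyContinuousCurve.comp_add {γ : ℝ → X} {J : Set ℝ} (t : ℝ)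
    (h : IsAbsolutelyContinuousCurve γ J) :
    IsAbsolutelyContinuousCurve (fun s => γ (s + t)) ((fun s => s + t) ⁻¹' J) := by
  intro ε hε
  obtain ⟨δ, hδ, h⟩ := h ε hε
  refine ⟨δ, hδ, fun a b hab hdisj hsum => h (fun n => a n + t) (fun n => b n + t)
    (fun n => ⟨by linarith [(hab n).1], (hab n).2⟩) (fun i j hij => ?_) (by simpa using hsum)⟩
  have := hdisj hij
  simp only [Set.disjoint_left] at this ⊢
  rintro x ⟨hx1, hx2⟩ ⟨hx3, hx4⟩
  exact this (a := x - t) ⟨by linarith, by linarith⟩ ⟨by linarith, by linarith⟩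

lemma LipschitzOnWith.isAbsolutelyContinuousCurve {γ : ℝ → X} {J : Set ℝ} {K : ℝ≥0}
    (h : LipschitzOnWith K γ J) : IsAbsolutelyContinuousCurve γ J := by
  intro ε hε
  refine ⟨ε / (K + 1), ENNReal.div_pos hε.ne' (by simp), fun a b hab _ hsum => ?_⟩
  calc ∑' n, edist (γ (a n)) (γ (b n))
      ≤ ∑' n, (K + 1 : ℝ≥0∞) * ENNReal.ofReal (b n - a n) := by
        refine ENNReal.tsum_le_tsum fun n => ?_
        refine (h (hab n).2.1 (hab n).2.2).trans ?_
        rw [edist_dist, Real.dist_eq, abs_sub_comm, abs_of_nonneg (by linarith [(hab n).1])]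
        gcongr
        exact le_self_add
    _ = (K + 1 : ℝ≥0∞) * ∑' n, ENNReal.ofReal (b n - a n) := ENNReal.tsum_mul_left
    _ < ε := by
        rw [mul_comm]
        exact (ENNReal.lt_div_iff_mul_lt (Or.inl (by simp)) (Or.inl (by simp))).1 hsum

/-- A curve which is absolutely continuous on both sides of a time is absolutely continuous. -/
lemma IsAbsolutelyContinuousCurve.union {γ : ℝ → X} {t T : ℝ}
    (h1 : IsAbsolutelyContinuousCurve γ (Iic t)) (h2 : IsAbsolutelyContinuousCurve γ (Icc t T)) :
    IsAbsolutelyContinuousCurve γ (Iic T) := by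
  intro ε hε
  obtain ⟨δ₁, hδ₁, h1⟩ := h1 (ε / 2) (ENNReal.half_pos hε.ne')
  obtain ⟨δ₂, hδ₂, h2⟩ := h2 (ε / 2) (ENNReal.half_pos hε.ne')
  refine ⟨min δ₁ δ₂, lt_min hδ₁ hδ₂, fun a b hab hdisj hsum => ?_⟩
  rcases lt_or_ge T t with hT | hT
  · refine (h1 a b (fun n => ⟨(hab n).1, ?_, ?_⟩) hdisj (hsum.trans_le (min_le_left _ _))).trans_le
      ENNReal.half_le_self
    · exact le_trans (hab n).2.1 hT.le
    · exact le_trans (hab n).2.2 hT.le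
  -- Each interval is cut at t: truncation by min gives the part before t, truncation by max the
  -- part after, and each family contributes less than ε/2.
  have e1 := h1 (fun n => min (a n) t) (fun n => min (b n) t)
    (fun n => ⟨min_le_min_right _ (hab n).1, mem_Iic.2 (min_le_right _ _),
      mem_Iic.2 (min_le_right _ _)⟩)
    (fun i j hij => (hdisj hij).mono (fun x hx => ?_) (fun x hx => ?_))
    (lt_of_le_of_lt (ENNReal.tsum_le_tsum fun n => ENNReal.ofReal_le_ofReal ?_)
      (hsum.trans_le (min_le_left _ _)))
  · have e2 := h2 (fun n => max (a n) t) (fun n => max (b n) t)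
      (fun n => ⟨max_le_max_right _ (hab n).1, ⟨le_max_right _ _, max_le (hab n).2.1 hT⟩,
        ⟨le_max_right _ _, max_le (hab n).2.2 hT⟩⟩)
      (fun i j hij => (hdisj hij).mono (fun x hx => ?_) (fun x hx => ?_))
      (lt_of_le_of_lt (ENNReal.tsum_le_tsum fun n => ENNReal.ofReal_le_ofReal ?_)
        (hsum.trans_le (min_le_right _ _)))
    · calc ∑' n, edist (γ (a n)) (γ (b n))
          ≤ ∑' n, (edist (γ (min (a n) t)) (γ (min (b n) t)) +
              edist (γ (max (a n) t)) (γ (max (b n) t))) := by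
            refine ENNReal.tsum_le_tsum fun n => ?_
            have := (hab n).1
            rcases le_total (a n) t with ha | ha <;> rcases le_total (b n) t with hb | hb
            · simp [ha, hb]
            · simpa [ha, hb] using edist_triangle _ _ _
            · have : a n = b n := by linarith
              simp [this]
            · simp [ha, hb]
        _ = _ := ENNReal.tsum_add
        _ < ε / 2 + ε / 2 := ENNReal.add_lt_add e1 e2
        _ = ε := ENNReal.add_halves ε
    · simp only [mem_Ioo, max_lt_iff, lt_max_iff] at hx ⊢
      grind
    · simp only [mem_Ioo, max_lt_iff, lt_max_iff] at hx ⊢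
      grind
    · have := (hab n).1
      rcases le_total (a n) t with ha | ha <;> rcases le_total (b n) t with hb | hb <;>
        simp [ha, hb] <;> linarith
  · simp only [mem_Ioo, min_lt_iff, lt_min_iff] at hx ⊢
    grind
  · simp only [mem_Ioo, min_lt_iff, lt_min_iff] at hx ⊢
    grind
  · have := (hab n).1
    rcases le_total (a n) t with ha | ha <;> rcases le_total (b n) t with hb | hb <;>
      simp [ha, hb] <;> linarith

/-- Curves which are absolutely continuous on a set are absolutely continuous, in the sense of
Mathlib, on the compact intervals contained in this set. -/
lemma IsAbsolutelyContinuousCurve.absolutelyContinuousOnInterval {γ : ℝ → X} {J : Set ℝ}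
    (h : IsAbsolutelyContinuousCurve γ J) {c d : ℝ} (hJ : uIcc c d ⊆ J) :
    AbsolutelyContinuousOnInterval γ c d := by
  rw [absolutelyContinuousOnInterval_iff]
  intro ε hε
  obtain ⟨δ, hδ, h⟩ := h (ENNReal.ofReal ε) (by simpa using hε)
  obtain ⟨r, hr, hrδ⟩ : ∃ r : ℝ, 0 < r ∧ ENNReal.ofReal r ≤ δ := by
    obtain ⟨r, hr, hrδ⟩ := ENNReal.lt_iff_exists_real_btwn.1 hδ
    exact ⟨r, by simpa using hrδ.1, hrδ.2.le⟩
  refine ⟨r, hr, ?_⟩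
  rintro ⟨n, I⟩ ⟨hI, hdisj⟩ hsum
  simp only at hI hdisj hsum ⊢
  -- A finite family with unordered end points becomes a sequence of intervals by sorting the end
  -- points and padding with the degenerate interval at c, which contributes nothing to either sum.
  let a : ℕ → ℝ := fun i => if i < n then min (I i).1 (I i).2 else c
  let b : ℕ → ℝ := fun i => if i < n then max (I i).1 (I i).2 else c
  have hsupp : ∀ f : ℝ → ℝ → ℝ≥0∞, (∀ x, f x x = 0) →
      ∑' i, f (a i) (b i) = ∑ i ∈ Finset.range n, f (a i) (b i) := by
    intro f hf
    refine tsum_eq_sum fun i hi => ?_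
    have : ¬ i < n := by simpa using hi
    simp [a, b, this, hf]
  have key := h a b (fun i => ?_) (fun i j hij => ?_) ?_
  · rw [hsupp (fun x y => edist (γ x) (γ y)) (fun x => edist_self _)] at key
    rw [← ENNReal.ofReal_lt_ofReal_iff hε, ENNReal.ofReal_sum_of_nonneg (fun _ _ => dist_nonneg)]
    refine lt_of_le_of_lt (Finset.sum_le_sum fun i hi => ?_) key
    have : i < n := by simpa using hi
    rw [← edist_dist]
    rcases le_total (I i).1 (I i).2 with hle | hle
    · simp [a, b, this, hle]
    · simp [a, b, this, hle, edist_comm]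
  · by_cases hi : i < n
    · have h1 := hI i (by simpa using hi)
      simp only [a, b, hi, if_true]
      refine ⟨min_le_max, ?_, ?_⟩
      · rcases min_choice (I i).1 (I i).2 with h2 | h2 <;> rw [h2]
        exacts [hJ h1.1, hJ h1.2]
      · rcases max_choice (I i).1 (I i).2 with h2 | h2 <;> rw [h2]
        exacts [hJ h1.1, hJ h1.2]
    · simp only [a, b, hi, if_false]
      exact ⟨le_rfl, hJ left_mem_uIcc, hJ left_mem_uIcc⟩
  · change Disjoint (Ioo (a i) (b i)) (Ioo (a j) (b j))
    by_cases hi : i < n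
    · by_cases hj : j < n
      · refine (hdisj (by simpa using hi) (by simpa using hj) hij).mono ?_ ?_
        · simp only [a, b, hi, if_true]
          exact Ioo_subset_Ioc_self
        · simp only [a, b, hj, if_true]
          exact Ioo_subset_Ioc_self
      · simp [a, b, hj]
    · simp [a, b, hi]
  · rw [hsupp (fun x y => ENNReal.ofReal (y - x)) (fun x => by simp)]
    refine lt_of_lt_of_le ?_ hrδ
    rw [← ENNReal.ofReal_sum_of_nonneg (fun i _ => ?_), ENNReal.ofReal_lt_ofReal_iff hr]
    · refine lt_of_le_of_lt (Finset.sum_le_sum fun i hi => ?_) hsum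
      have : i < n := by simpa using hi
      simp only [a, b, this, if_true, Real.dist_eq, max_sub_min_eq_abs']
      exact le_rfl
    · simp only [a, b]
      split_ifs <;> simp

end AbsolutelyContinuousCurves

/-! ### Absolute continuity under Lipschitz maps. -/

section Composition

open scoped NNReal

variable {X Y : Type*} [PseudoMetricSpace X] [PseudoMetricSpace Y]

lemma _root_.LipschitzOnWith.comp_absolutelyContinuousOnInterval {f : X → Y} {s : Set X} {K : ℝ≥0}
    (hf : LipschitzOnWith K f s) {γ : ℝ → X} {a b : ℝ} (hγ : AbsolutelyContinuousOnInterval γ a b)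
    (hs : MapsTo γ (uIcc a b) s) : AbsolutelyContinuousOnInterval (f ∘ γ) a b := by
  rw [absolutelyContinuousOnInterval_iff] at hγ ⊢
  intro ε hε
  obtain ⟨δ, hδ, h⟩ := hγ (ε / (K + 1)) (by positivity)
  refine ⟨δ, hδ, fun E hE hsum => ?_⟩
  have h1 := h E hE hsum
  rw [lt_div_iff₀ (by positivity)] at h1
  refine lt_of_le_of_lt ?_ h1
  rw [Finset.sum_mul]
  refine Finset.sum_le_sum fun i hi => ?_
  refine (hf.dist_le_mul _ (hs (hE.1 i hi).1) _ (hs (hE.1 i hi).2)).trans ?_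
  rw [mul_comm]
  gcongr
  linarith

end Composition
end DiscountedHJ

namespace DiscountedHJ

/-! ### Finiteness of the value function and dynamic programming. -/

section Value

open scoped NNReal

variable {m : ℕ} {M : Type*} [MetricSpace M] [ChartedSpace (EuclideanSpace ℝ (Fin m)) M]
  {H : ∀ x : M, Cotangent (m := m) x → ℝ} {C lam : ℝ}

lemma neg_div_le_discountedAction
    (hC : ∀ (x : M) (v : TangentSpace (𝓡 m) x), -C ≤ lagrangian H x v) (hlam : 0 < lam)
    (γ : ℝ → M) : ((-C / lam : ℝ) : EReal) ≤ discountedAction H lam γ := by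
  have h1 : IntegrableOn (fun s => -C * Real.exp (lam * s)) (Iic 0) :=
    (integrableOn_exp_mul_Iic hlam 0).const_mul (-C)
  have h2 : ∫ s in Iic (0 : ℝ), -C * Real.exp (lam * s) = -C / lam := by
    rw [integral_const_mul, integral_exp_mul_Iic hlam]
    simp [div_eq_mul_inv]
  rw [← h2, ← extendedIntegral_eq_integral h1, discountedAction_eq]
  refine extendedIntegral_mono (Filter.Eventually.of_forall fun s => ?_)
  rw [mul_comm, discountedIntegrand]
  exact mul_le_mul_of_nonneg_left (hC _ _) (Real.exp_pos _).le

/-- The constant curve is the competitor that keeps the value function below +∞. -/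
lemma discountedAction_const (H : ∀ x : M, Cotangent (m := m) x → ℝ) (hlam : 0 < lam) (x : M) :
    discountedAction H lam (fun _ => x) = ((lagrangian H x 0 / lam : ℝ) : EReal) := by
  have h1 : IntegrableOn (fun s => lagrangian H x 0 * Real.exp (lam * s)) (Iic 0) :=
    (integrableOn_exp_mul_Iic hlam 0).const_mul _
  have h2 : ∫ s in Iic (0 : ℝ), lagrangian H x 0 * Real.exp (lam * s) = lagrangian H x 0 / lam := by
    rw [integral_const_mul, integral_exp_mul_Iic hlam]
    simp [div_eq_mul_inv]
  rw [← h2, ← extendedIntegral_eq_integral h1, discountedAction_eq]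
  refine extendedIntegral_congr (Filter.Eventually.of_forall fun s => ?_)
  have h3 : velocity (m := m) (fun _ : ℝ => x) s = 0 := by
    rw [velocity, mfderiv_const]
    rfl
  rw [discountedIntegrand, h3, mul_comm]

lemma discountedValue_le {γ : ℝ → M} (hγ : IsAbsolutelyContinuousCurve γ (Iic 0)) :
    discountedValue H lam (γ 0) ≤ discountedAction H lam γ :=
  iInf₂_le (f := fun (γ : ℝ → M) _ => discountedAction H lam γ) γ ⟨hγ, rfl⟩

lemma neg_div_le_discountedValue
    (hC : ∀ (x : M) (v : TangentSpace (𝓡 m) x), -C ≤ lagrangian H x v) (hlam : 0 < lam) (x : M) :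
    ((-C / lam : ℝ) : EReal) ≤ discountedValue H lam x :=
  le_iInf₂ fun γ _ => neg_div_le_discountedAction hC hlam γ

/-- The discounted value function is real valued. -/
lemma coe_toReal_discountedValue
    (hC : ∀ (x : M) (v : TangentSpace (𝓡 m) x), -C ≤ lagrangian H x v) (hlam : 0 < lam) (x : M) :
    ((discountedValue H lam x).toReal : EReal) = discountedValue H lam x := by
  refine EReal.coe_toReal (ne_top_of_le_ne_top (EReal.coe_ne_top _)
    ((discountedValue_le (isAbsolutelyContinuousCurve_const x _)).trans_eq
      (discountedAction_const H hlam x))) ?_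
  exact ne_bot_of_le_ne_bot (EReal.coe_ne_bot _) (neg_div_le_discountedValue hC hlam x)

/-- Lower bound of the action by the value function at a former point. -/
lemma le_discountedAction
    (hC : ∀ (x : M) (v : TangentSpace (𝓡 m) x), -C ≤ lagrangian H x v) (hlam : 0 < lam)
    {γ : ℝ → M} (hγ : IsAbsolutelyContinuousCurve γ (Iic 0)) {t : ℝ} (ht : 0 ≤ t) {J : ℝ}
    (hJ : (J : EReal) ≤ extendedIntegral (discountedIntegrand H lam γ) (Ioc (-t) 0)) :
    ((Real.exp (-(lam * t)) * (discountedValue H lam (γ (-t))).toReal + J : ℝ) : EReal) ≤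
      discountedAction H lam γ := by
  rw [discountedAction_eq_add hC hlam γ ht, EReal.coe_add, EReal.coe_mul,
    coe_toReal_discountedValue hC hlam]
  refine add_le_add (mul_le_mul_of_nonneg_left ?_ (EReal.coe_nonneg.2 (Real.exp_pos _).le)) hJ
  -- The past of γ before -t, translated to end at time 0, is a competitor for the value at γ(-t).
  have h1 : IsAbsolutelyContinuousCurve (fun s => γ (s - t)) (Iic 0) :=
    (hγ.comp_add (-t)).mono fun s hs => by
      simp only [mem_Iic, mem_preimage] at hs ⊢
      linarith
  simpa using discountedValue_le (H := H) (lam := lam) h1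

lemma integral_exp_mul_Ioc (hlam : lam ≠ 0) {t : ℝ} (ht : 0 ≤ t) :
    ∫ s in Ioc (-t) 0, Real.exp (lam * s) = (1 - Real.exp (-(lam * t))) / lam := by
  rw [← intervalIntegral.integral_of_le (by linarith),
    intervalIntegral.integral_comp_mul_left (fun s => Real.exp s) hlam, integral_exp]
  simp [div_eq_inv_mul]

/-- Upper bound of the value function through a Lipschitz curve with bounded Lagrangian. -/
lemma discountedValue_le_add
    (hC : ∀ (x : M) (v : TangentSpace (𝓡 m) x), -C ≤ lagrangian H x v) (hlam : 0 < lam)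
    {σ : ℝ → M} {t : ℝ} (ht : 0 ≤ t) {κ : ℝ≥0} (hσ : LipschitzOnWith κ σ (Icc (-t) 0)) {K : ℝ}
    (hK : ∀ s ∈ Ioo (-t) 0, lagrangian H (σ s) (velocity σ s) ≤ K) :
    (discountedValue H lam (σ 0)).toReal ≤
      Real.exp (-(lam * t)) * (discountedValue H lam (σ (-t))).toReal +
        K * ((1 - Real.exp (-(lam * t))) / lam) := by
  set J := K * ((1 - Real.exp (-(lam * t))) / lam) with hJ
  set e := Real.exp (-(lam * t)) with he
  have he0 : 0 < e := Real.exp_pos _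
  by_contra! hlt
  -- Failure of the inequality leaves a gap above the value at σ(-t), and this gap selects a
  -- near-optimal past η.
  have h1 : discountedValue H lam (σ (-t)) <
      (((discountedValue H lam (σ 0)).toReal - J) / e : ℝ) := by
    rw [← coe_toReal_discountedValue hC hlam, EReal.coe_lt_coe_iff, lt_div_iff₀ he0]
    linarith
  obtain ⟨r, hr⟩ : ∃ r, r = ((discountedValue H lam (σ 0)).toReal - J) / e := ⟨_, rfl⟩
  rw [← hr] at h1
  simp only [discountedValue, iInf_lt_iff] at h1
  obtain ⟨η, ⟨hη, hη0⟩, hlt'⟩ := h1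
  -- Concatenation: η delayed by t, followed by σ on [-t, 0].
  let γ : ℝ → M := fun s => if s ≤ -t then η (s + t) else σ s
  have hγ1 : ∀ s, s ≤ -t → γ s = η (s + t) := fun s hs => if_pos hs
  have hγ2 : ∀ s, -t ≤ s → γ s = σ s := by
    intro s hs
    rcases hs.eq_or_lt with rfl | hs
    · rw [hγ1 _ le_rfl, neg_add_cancel, hη0]
    · exact if_neg (not_le.2 hs)
  have hac : IsAbsolutelyContinuousCurve γ (Iic 0) := by
    refine IsAbsolutelyContinuousCurve.union (t := -t) ?_ ?_
    · refine ((hη.comp_add t).mono fun s hs => ?_).congr fun s hs => (hγ1 s hs).symm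
      simp only [mem_Iic, mem_preimage] at hs ⊢
      linarith
    · exact (LipschitzOnWith.isAbsolutelyContinuousCurve hσ).congr fun s hs => (hγ2 s hs.1).symm
  have h2 := discountedValue_le (H := H) (lam := lam) hac
  rw [hγ2 0 (by linarith), discountedAction_eq_add hC hlam γ ht] at h2
  have h3 : discountedAction H lam (fun s => γ (s - t)) = discountedAction H lam η :=
    discountedAction_congr fun s hs => by
      have : s ≤ 0 := hs
      rw [hγ1 _ (by linarith), sub_add_cancel]
  have h4 : IntegrableOn (fun s => K * Real.exp (lam * s)) (Ioc (-t) 0) :=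
    Continuous.integrableOn_Ioc (by fun_prop)
  have h5 : extendedIntegral (discountedIntegrand H lam γ) (Ioc (-t) 0) ≤ (J : EReal) := by
    rw [hJ, he, ← integral_exp_mul_Ioc hlam.ne' ht, ← integral_const_mul,
      ← extendedIntegral_eq_integral h4]
    refine extendedIntegral_mono ?_
    rw [← restrict_Ioo_eq_restrict_Ioc]
    filter_upwards [self_mem_ae_restrict measurableSet_Ioo] with s hs
    have h6 : γ =ᶠ[𝓝 s] σ := by
      filter_upwards [Ioi_mem_nhds hs.1] with r hr using hγ2 r (le_of_lt hr)
    rw [discountedIntegrand_congr h6, discountedIntegrand, mul_comm]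
    exact mul_le_mul_of_nonneg_right (hK s hs) (Real.exp_pos _).le
  rw [h3] at h2
  have h6 : discountedAction H lam η ≠ ⊤ := (hlt'.trans (EReal.coe_lt_top _)).ne
  have h7 : discountedAction H lam η ≠ ⊥ :=
    ne_bot_of_le_ne_bot (EReal.coe_ne_bot _) (neg_div_le_discountedAction hC hlam η)
  lift discountedAction H lam η to ℝ using ⟨h6, h7⟩ with a
  have h8 := h2.trans (add_le_add le_rfl h5)
  rw [← coe_toReal_discountedValue hC hlam] at h8
  norm_cast at h8 hlt'
  rw [hr, lt_div_iff₀ he0] at hlt'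
  rw [← he] at h8
  linarith

end Value
end DiscountedHJ

namespace DiscountedHJ

/-! ### Continuity and the subsolution property of the value function. -/

section Regularity

open scoped NNReal

variable {m : ℕ} {M : Type*} [MetricSpace M] [ChartedSpace (EuclideanSpace ℝ (Fin m)) M] [IsManifold (𝓡 m) ∞ M]
  {H : ∀ x : M, Cotangent (m := m) x → ℝ} {C lam : ℝ}

/-- Upper bound of the value function along a segment in a chart. -/
lemma discountedValue_segment_le
    (hC : ∀ (x : M) (v : TangentSpace (𝓡 m) x), -C ≤ lagrangian H x v) (hlam : 0 < lam) {x₀ : M}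
    {B : Set (EuclideanSpace ℝ (Fin m))} (hB : Convex ℝ B) (hBt : B ⊆ (extChartAt (𝓡 m) x₀).target) {κ : ℝ≥0}
    (hκ : LipschitzOnWith κ (extChartAt (𝓡 m) x₀).symm B) {w : EuclideanSpace ℝ (Fin m)} {K : ℝ}
    (hK : ∀ z ∈ B, ∀ v : TangentSpace (𝓡 m) ((extChartAt (𝓡 m) x₀).symm z),
      toModel x₀ _ v = w → lagrangian H _ v ≤ K)
    {z : EuclideanSpace ℝ (Fin m)} {t : ℝ} (ht : 0 ≤ t) (hz : z ∈ B) (hz' : z - t • w ∈ B) :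
    (discountedValue H lam ((extChartAt (𝓡 m) x₀).symm z)).toReal ≤
      Real.exp (-(lam * t)) *
        (discountedValue H lam ((extChartAt (𝓡 m) x₀).symm (z - t • w))).toReal +
        K * ((1 - Real.exp (-(lam * t))) / lam) := by
  let c : ℝ → EuclideanSpace ℝ (Fin m) := fun s => z + s • w
  have hcB : ∀ s ∈ Icc (-t) 0, c s ∈ B := by
    intro s hs
    rcases ht.eq_or_lt with rfl | ht
    · have : s = 0 := le_antisymm hs.2 (by simpa using hs.1)
      simpa [c, this] using hz
    · have h1 := hB hz' hz (a := -s / t) (b := 1 + s / t) (div_nonneg (by linarith [hs.2]) ht.le)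
        (by rw [← neg_le_iff_add_nonneg', le_div_iff₀ ht]; linarith [hs.1]) (by ring)
      convert h1 using 1
      simp only [c, smul_sub, smul_smul, neg_div, neg_mul, div_mul_cancel₀ _ ht.ne']
      module
  have hcd : ∀ s, HasDerivAt c w s := fun s => by
    have h := ((hasDerivAt_id s).smul_const w).const_add z
    rw [one_smul] at h
    exact h
  have hcl : LipschitzWith ‖w‖₊ c := by
    refine LipschitzWith.of_dist_le_mul fun s s' => ?_
    have h : z + s • w - (z + s' • w) = (s - s') • w := by module
    simp only [c, dist_eq_norm, coe_nnnorm, h, norm_smul]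
    rw [mul_comm]
  have h := discountedValue_le_add (H := H) (lam := lam) hC hlam
    (σ := (extChartAt (𝓡 m) x₀).symm ∘ c) ht
    (hκ.comp (hcl.lipschitzOnWith (s := Icc (-t) 0)) hcB) (K := K) fun s hs => by
      have hs' := hcB s (Ioo_subset_Icc_self hs)
      exact hK (c s) hs' _ (toModel_velocity_eq (hcd s) (hBt hs') Filter.EventuallyEq.rfl)
  simpa [c, sub_eq_add_neg] using h

variable [Bundle.RiemannianBundle (fun x : M => TangentSpace (𝓡 m) x)]
  [IsContinuousRiemannianBundle (EuclideanSpace ℝ (Fin m)) (fun x : M => TangentSpace (𝓡 m) x)]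
  [IsRiemannianManifold (𝓡 m) M]

/-- In a chart, z is reached from z' along a segment with velocity of norm at most one in time |z -
z'|. Since L is locally bounded on such velocities and u is bounded below, dynamic programming
bounds u(z) - u(z') by a multiple of this time. -/
lemma continuous_toReal_discountedValue
    (hC : ∀ (x : M) (v : TangentSpace (𝓡 m) x), -C ≤ lagrangian H x v) (hlam : 0 < lam)
    (hcont : IsContinuousHamiltonian H) (hsuper : IsSuperlinearHamiltonian H) :
    Continuous fun x : M => (discountedValue H lam x).toReal := by
  rw [continuous_iff_continuousAt]
  intro x₀
  obtain ⟨K, hK⟩ := exists_eventually_lagrangian_le hcont hsuper x₀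
  obtain ⟨κ, s, hs, hκ⟩ := exists_lipschitzOnWith_extChartAt_symm (m := m) x₀
  obtain ⟨r, hr, hball⟩ := Metric.mem_nhds_iff.1
    (Filter.inter_mem (Filter.inter_mem hK hs) (extChartAt_target_mem_nhds (I := 𝓡 m) x₀))
  set z₀ := extChartAt (𝓡 m) x₀ x₀
  set U : EuclideanSpace ℝ (Fin m) → ℝ := fun z => (discountedValue H lam ((extChartAt (𝓡 m) x₀).symm z)).toReal with hU
  have hUlow : ∀ z, -C / lam ≤ U z := fun z => by
    have := neg_div_le_discountedValue hC hlam ((extChartAt (𝓡 m) x₀).symm z)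
    rw [← coe_toReal_discountedValue hC hlam] at this
    exact_mod_cast this
  have key : ∀ z ∈ Metric.ball z₀ r, ∀ z' ∈ Metric.ball z₀ r,
      U z ≤ U z' + (|K| + |C|) * dist z z' := by
    intro z hz z' hz'
    set t := dist z z' with ht
    -- If z = z', then t⁻¹ = 0 and w = 0, and both properties of w used below still hold.
    set w := t⁻¹ • (z - z') with hw
    have ht0 : 0 ≤ t := dist_nonneg
    have hw1 : ‖w‖ ≤ 1 := by
      rw [hw, norm_smul, norm_inv, Real.norm_of_nonneg ht0, ← dist_eq_norm, ← ht]
      exact inv_mul_le_one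
    have hzw : z - t • w = z' := by
      rcases ht0.eq_or_lt with h0 | h0
      · have : z = z' := dist_eq_zero.1 (ht.symm.trans h0.symm)
        simp [← h0, this]
      · rw [hw, smul_inv_smul₀ h0.ne', sub_sub_cancel]
    have h1 := discountedValue_segment_le hC hlam (convex_ball z₀ r)
      (fun y hy => (hball hy).2) (hκ.mono fun y hy => (hball hy).1.2) (w := w) (K := K)
      (fun y hy v hv => (hball hy).1.1 v (hv ▸ hw1)) ht0 hz (by rwa [hzw])
    rw [hzw] at h1
    change U z ≤ _ * U z' + _ at h1
    have h2 : 1 - Real.exp (-(lam * t)) ≤ lam * t := by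
      linarith [Real.add_one_le_exp (-(lam * t))]
    have h3 : 0 ≤ 1 - Real.exp (-(lam * t)) := by
      linarith [Real.exp_le_one_iff.2 (show -(lam * t) ≤ 0 by nlinarith)]
    -- Dynamic programming reads U z - U z' ≤ (K/λ - U z')(1 - e^{-λt}), so a lower bound for U is
    -- what is needed.
    have h4 : K / lam - U z' ≤ (|K| + |C|) / lam := by
      have h5 := hUlow z'
      have h6 : K / lam - -C / lam ≤ (|K| + |C|) / lam := by
        rw [← sub_div]
        exact div_le_div_of_nonneg_right (by linarith [le_abs_self K, le_abs_self C]) hlam.le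
      linarith
    have h5 : (K / lam - U z') * (1 - Real.exp (-(lam * t))) ≤ (|K| + |C|) / lam * (lam * t) :=
      (mul_le_mul_of_nonneg_right h4 h3).trans (mul_le_mul_of_nonneg_left h2 (by positivity))
    have h6 : (|K| + |C|) / lam * (lam * t) = (|K| + |C|) * t := by field_simp
    have h7 : K * ((1 - Real.exp (-(lam * t))) / lam) =
      K / lam * (1 - Real.exp (-(lam * t))) := by ring
    linarith
  have hUc : ContinuousAt U z₀ := by
    have : LipschitzOnWith (|K| + |C|).toNNReal U (Metric.ball z₀ r) := by
      refine LipschitzOnWith.of_le_add_mul _ fun z hz z' hz' => ?_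
      rw [Real.coe_toNNReal _ (by positivity)]
      exact key z hz z' hz'
    exact this.continuousOn.continuousAt (Metric.ball_mem_nhds z₀ hr)
  have h1 : ContinuousAt (fun x => U (extChartAt (𝓡 m) x₀ x)) x₀ :=
    ContinuousAt.comp (g := U) hUc (continuousAt_extChartAt x₀)
  refine h1.congr ?_
  filter_upwards [eventually_extChartAt_symm_extChartAt (mem_extChartAt_source (I := 𝓡 m) x₀)]
    with x hx
  simp only [hU, hx]

/-- The discounted value function is a viscosity subsolution. -/
lemma isViscositySubsolution_discountedValue
    (hC : ∀ (x : M) (v : TangentSpace (𝓡 m) x), -C ≤ lagrangian H x v) (hlam : 0 < lam)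
    (hcont : IsContinuousHamiltonian H) (hconv : IsConvexHamiltonian H)
    (hsuper : IsSuperlinearHamiltonian H) :
    IsViscositySubsolution (discountedOperator H lam)
      fun x : M => (discountedValue H lam x).toReal := by
  refine ⟨continuous_toReal_discountedValue hC hlam hcont hsuper, fun x₀ p hp => ?_⟩
  obtain ⟨ϕ, hϕ, hmax, hpϕ⟩ := exists_of_mem_superdifferential hp
  rw [discountedOperator]
  by_contra! hpos
  set u₀ := (discountedValue H lam x₀).toReal
  set z₀ := extChartAt (𝓡 m) x₀ x₀ with hz₀
  obtain ⟨a, ha1, ha2⟩ := exists_between (show -(lam * u₀) < H x₀ p by linarith)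
  obtain ⟨v, hv⟩ := exists_lagrangian_le_sub hcont hconv x₀ p ha2
  set w := toModel x₀ x₀ v with hw
  -- Half of the gap a + λu₀ is spent on bounding L near x₀ along the constant chart velocity w; the
  -- other half keeps the derivative of g below negative.
  set K := lagrangian H x₀ v + (lam * u₀ + a) / 2 with hK
  have hL := eventually_lagrangian_le_add hcont hsuper x₀ v
    (show 0 < (lam * u₀ + a) / 2 by linarith)
  obtain ⟨κ, s, hs, hκ⟩ := exists_lipschitzOnWith_extChartAt_symm (m := m) x₀
  obtain ⟨r, hr, hball⟩ := Metric.mem_nhds_iff.1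
    (Filter.inter_mem (Filter.inter_mem (Filter.inter_mem hL hs)
      (extChartAt_target_mem_nhds (I := 𝓡 m) x₀)) hmax)
  -- This is the dynamic programming bound minus u₀, with u replaced by its majorant u₀ + ϕ - ϕ(z₀).
  -- Hence g ≥ 0 for small t > 0 while g(0) = 0, which forces g'(0) ≥ 0.
  let g : ℝ → ℝ := fun t => Real.exp (-(lam * t)) * (u₀ + ϕ (z₀ - t • w) - ϕ z₀) +
    K * ((1 - Real.exp (-(lam * t))) / lam) - u₀
  have hg0 : g 0 = 0 := by simp [g]
  have hge : ∀ᶠ t in 𝓝[>] (0 : ℝ), 0 ≤ g t := by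
    have hc : Filter.Tendsto (fun t : ℝ => z₀ - t • w) (𝓝[>] 0) (𝓝 z₀) := by
      have : Continuous fun t : ℝ => z₀ - t • w := by fun_prop
      simpa using (this.tendsto 0).mono_left nhdsWithin_le_nhds
    filter_upwards [hc.eventually (Metric.ball_mem_nhds z₀ hr), self_mem_nhdsWithin] with t ht ht0
    have h1 := discountedValue_segment_le hC hlam (convex_ball z₀ r)
      (fun y hy => (hball hy).1.2) (hκ.mono fun y hy => (hball hy).1.1.2) (w := w) (K := K)
      (fun y hy v' hv' => (hball hy).1.1.1 v' hv') (le_of_lt ht0) (Metric.mem_ball_self hr) ht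
    have h2 := (hball ht).2
    simp only [mem_ofPred_eq, hz₀, extChartAt_to_inv] at h1 h2
    have h3 := mul_le_mul_of_nonneg_left
      (show (discountedValue H lam ((extChartAt (𝓡 m) x₀).symm (z₀ - t • w))).toReal ≤
        u₀ + ϕ (z₀ - t • w) - ϕ z₀ by linarith) (Real.exp_pos (-(lam * t))).le
    simp only [g]
    linarith
  have hexp : HasDerivAt (fun t : ℝ => Real.exp (-(lam * t))) (-lam) 0 := by
    have := (((hasDerivAt_id (0 : ℝ)).const_mul lam).neg).exp
    simpa using this
  have hϕd : HasDerivAt (fun t : ℝ => ϕ (z₀ - t • w)) (-(p v)) 0 := by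
    have h1 : HasDerivAt (fun t : ℝ => z₀ - t • w) (-w) 0 := by
      simpa using ((hasDerivAt_id (0 : ℝ)).smul_const w).const_sub z₀
    have h2 : HasFDerivAt ϕ (fderiv ℝ ϕ z₀) (z₀ - (0 : ℝ) • w) := by
      simpa using (hϕ.differentiableAt one_ne_zero).hasFDerivAt
    have h3 := h2.comp_hasDerivAt 0 h1
    have h4 : p v = fderiv ℝ ϕ z₀ w := by rw [hpϕ]; rfl
    rw [h4, ← map_neg]
    exact h3
  have hgd : HasDerivAt g (-lam * u₀ - p v + K) 0 := by
    have h1 := ((hexp.mul ((hϕd.const_add u₀).sub_const (ϕ z₀))).add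
      (((hexp.const_sub 1).div_const lam).const_mul K)).sub_const u₀
    refine h1.congr_deriv ?_
    simp only [zero_smul, sub_zero, mul_zero, neg_zero, Real.exp_zero]
    field_simp
    ring
  have h1 := (hasDerivWithinAt_iff_tendsto_slope' self_notMem_Ioi).1
    (hgd.hasDerivWithinAt (s := Ioi 0))
  have h2 : 0 ≤ -lam * u₀ - p v + K := by
    refine ge_of_tendsto h1 ?_
    filter_upwards [hge, self_mem_nhdsWithin] with t ht ht0
    rw [slope_def_field, hg0]
    exact div_nonneg (by linarith) (by simpa using le_of_lt ht0)
  linarith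

end Regularity
end DiscountedHJ

namespace DiscountedHJ

/-! ### Exit times of continuous curves. -/

section Exit

lemma IsAbsolutelyContinuousCurve.continuousOn_Icc {X : Type*} [PseudoMetricSpace X] {γ : ℝ → X}
    (hγ : IsAbsolutelyContinuousCurve γ (Iic 0)) {T : ℝ} (hT : 0 ≤ T) :
    ContinuousOn γ (Icc (-T) 0) := by
  have hu : uIcc (-T) 0 = Icc (-T) 0 := uIcc_of_le (neg_nonpos.2 hT)
  have h2 : AbsolutelyContinuousOnInterval γ (-T) 0 :=
    hγ.absolutelyContinuousOnInterval (by rw [hu]; exact fun s hs => hs.2)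
  intro s hs
  rw [ContinuousWithinAt, tendsto_iff_dist_tendsto_zero]
  have h3 : AbsolutelyContinuousOnInterval ((fun x => dist x (γ s)) ∘ γ) (-T) 0 :=
    (LipschitzWith.dist_left (γ s)).lipschitzOnWith.comp_absolutelyContinuousOnInterval h2
      (mapsTo_univ _ _)
  have h4 := h3.continuousOn
  rw [hu] at h4
  simpa [ContinuousWithinAt, Function.comp_def] using h4 s hs

/-- Following a curve backward from an open set `G` contained in a closed set `A`, either the curve
stays in `A` up to time `T`, or it leaves `G` at some time before which it stays in `A`. -/
lemma exists_exit_time {X : Type*} [TopologicalSpace X] {γ : ℝ → X} {T : ℝ} (hT : 0 ≤ T)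
    (hγ : ContinuousOn γ (Icc (-T) 0)) {A G : Set X} (hA : IsClosed A) (hG : IsOpen G)
    (hGA : G ⊆ A) (h0 : γ 0 ∈ G) :
    ∃ τ ∈ Icc 0 T, MapsTo γ (Icc (-τ) 0) A ∧ (τ = T ∨ γ (-τ) ∉ G) := by
  -- The times spent outside G. The largest of them is the exit time: afterwards the curve is in G ⊆
  -- A, and at that time itself it is in A because A is closed.
  set S := Icc (-T) 0 ∩ γ ⁻¹' Gᶜ with hS
  have hSc : IsClosed S := hγ.preimage_isClosed_of_isClosed isClosed_Icc hG.isClosed_compl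
  rcases S.eq_empty_or_nonempty with hne | hne
  · refine ⟨T, ⟨hT, le_rfl⟩, fun s hs => hGA ?_, Or.inl rfl⟩
    by_contra h
    have : s ∈ S := ⟨hs, h⟩
    simp [hne] at this
  have hmem : sSup S ∈ S :=
    (isCompact_Icc.of_isClosed_subset hSc inter_subset_left).sSup_mem hne
  set s := sSup S
  have hs0 : s < 0 := lt_of_le_of_ne hmem.1.2 fun h => hmem.2 (h ▸ h0)
  refine ⟨-s, ⟨by linarith, by linarith [hmem.1.1]⟩, ?_, Or.inr (by simpa using hmem.2)⟩
  rw [neg_neg]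
  have h1 : MapsTo γ (Ioo s 0) A := by
    intro t ht
    refine hGA ?_
    by_contra h
    have h2 : t ∈ S := ⟨⟨hmem.1.1.trans ht.1.le, ht.2.le⟩, h⟩
    exact absurd (le_csSup ⟨0, fun x hx => hx.1.2⟩ h2) (not_le.2 ht.1)
  have h2 := h1.closure_of_continuousOn (by
    rw [closure_Ioo hs0.ne]
    exact hγ.mono (Icc_subset_Icc_left hmem.1.1))
  rwa [closure_Ioo hs0.ne, hA.closure_eq] at h2

end Exit

/-! ### The supersolution property of the value function. -/

section Supersolution

open scoped NNReal

variable {m : ℕ} {M : Type*} [MetricSpace M] [ChartedSpace (EuclideanSpace ℝ (Fin m)) M] [IsManifold (𝓡 m) ∞ M]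
  {H : ∀ x : M, Cotangent (m := m) x → ℝ} {C lam : ℝ}
  [Bundle.RiemannianBundle (fun x : M => TangentSpace (𝓡 m) x)]
  [IsContinuousRiemannianBundle (EuclideanSpace ℝ (Fin m)) (fun x : M => TangentSpace (𝓡 m) x)]

/-- The variation of a classical strict subsolution along an absolutely continuous curve is bounded
by the action. -/
lemma sub_le_extendedIntegral (hcont : IsContinuousHamiltonian H)
    (hsuper : IsSuperlinearHamiltonian H) {x₀ : M} {A : Set M}
    (hA : A ⊆ (extChartAt (𝓡 m) x₀).source) {κ κ' : ℝ≥0}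
    (hκ : LipschitzOnWith κ (extChartAt (𝓡 m) x₀) A) {ψ : EuclideanSpace ℝ (Fin m) → ℝ}
    (hψ : LipschitzOnWith κ' ψ (extChartAt (𝓡 m) x₀ '' A))
    (hψd : ∀ y ∈ A, DifferentiableAt ℝ ψ (extChartAt (𝓡 m) x₀ y))
    (hsub : ∀ y ∈ A, lam * ψ (extChartAt (𝓡 m) x₀ y) + localHamiltonian H x₀
      (extChartAt (𝓡 m) x₀ y) (fderiv ℝ ψ (extChartAt (𝓡 m) x₀ y)) ≤ 0)
    {γ : ℝ → M} (hγ : IsAbsolutelyContinuousCurve γ (Iic 0)) {τ : ℝ} (hτ : 0 ≤ τ)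
    (hγA : MapsTo γ (Icc (-τ) 0) A) :
    ((ψ (extChartAt (𝓡 m) x₀ (γ 0)) -
        Real.exp (-(lam * τ)) * ψ (extChartAt (𝓡 m) x₀ (γ (-τ))) : ℝ) : EReal) ≤
      extendedIntegral (discountedIntegrand H lam γ) (Ioc (-τ) 0) := by
  have hle : -τ ≤ 0 := by linarith
  have huI : uIcc (-τ) 0 = Icc (-τ) 0 := uIcc_of_le hle
  set c : ℝ → EuclideanSpace ℝ (Fin m) := extChartAt (𝓡 m) x₀ ∘ γ with hc
  have hγac : AbsolutelyContinuousOnInterval γ (-τ) 0 :=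
    hγ.absolutelyContinuousOnInterval (by rw [huI]; exact fun s hs => hs.2)
  have hcac : AbsolutelyContinuousOnInterval c (-τ) 0 :=
    hκ.comp_absolutelyContinuousOnInterval hγac (by rwa [huI])
  have hψac : AbsolutelyContinuousOnInterval (ψ ∘ c) (-τ) 0 :=
    hψ.comp_absolutelyContinuousOnInterval hcac (by
      rw [huI]
      exact fun s hs => mem_image_of_mem _ (hγA hs))
  have hexp : AbsolutelyContinuousOnInterval (fun s => Real.exp (lam * s)) (-τ) 0 := by
    have : ContDiff ℝ 1 fun s => Real.exp (lam * s) := by fun_prop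
    exact this.contDiffOn.absolutelyContinuousOnInterval
  -- Almost everywhere g' = e^{λs}(λψ + dψ·c') ≤ e^{λs}(dψ·c' - H) ≤ e^{λs}L, by the subsolution
  -- inequality and then Fenchel's. Absolute continuity allows g' to be integrated back.
  set g : ℝ → ℝ := fun s => Real.exp (lam * s) * ψ (c s) with hg
  have hgac : AbsolutelyContinuousOnInterval g (-τ) 0 := hexp.mul hψac
  have hint := hgac.integral_deriv_eq_sub
  have hgi : IntegrableOn (deriv g) (Ioc (-τ) 0) :=
    (intervalIntegrable_iff_integrableOn_Ioc_of_le hle).1 hgac.intervalIntegrable_deriv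
  rw [intervalIntegral.integral_of_le hle] at hint
  have h1 : ψ (extChartAt (𝓡 m) x₀ (γ 0)) -
      Real.exp (-(lam * τ)) * ψ (extChartAt (𝓡 m) x₀ (γ (-τ))) =
      ∫ s in Ioc (-τ) 0, deriv g s := by
    rw [hint]
    simp [hg, hc]
  rw [h1, ← extendedIntegral_eq_integral hgi]
  refine extendedIntegral_mono ?_
  rw [← restrict_Ioo_eq_restrict_Ioc]
  have hcd : ∀ᵐ s, s ∈ uIcc (-τ) 0 → DifferentiableAt ℝ c s :=
    hcac.boundedVariationOn.ae_differentiableAt_of_mem_uIcc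
  filter_upwards [self_mem_ae_restrict measurableSet_Ioo, ae_restrict_of_ae hcd] with s hs hsd
  have hsI : s ∈ Icc (-τ) 0 := Ioo_subset_Icc_self hs
  replace hsd := hsd (by rwa [huI])
  have hy := hA (hγA hsI)
  have hγc : γ =ᶠ[𝓝 s] (extChartAt (𝓡 m) x₀).symm ∘ c := by
    filter_upwards [Icc_mem_nhds hs.1 hs.2] with t ht
    exact ((extChartAt (𝓡 m) x₀).left_inv (hA (hγA ht))).symm
  have hcs : HasDerivAt c (toModel x₀ (γ s) (velocity γ s)) s := by
    rw [toModel_velocity_eq hsd.hasDerivAt ((extChartAt (𝓡 m) x₀).map_source hy) hγc]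
    exact hsd.hasDerivAt
  set v := velocity (m := m) γ s
  have hgd : HasDerivAt g (Real.exp (lam * s) * (lam * 1) * ψ (c s) +
      Real.exp (lam * s) * fderiv ℝ ψ (c s) (toModel x₀ (γ s) v)) s :=
    (((hasDerivAt_id s).const_mul lam).exp).mul
      ((hψd _ (hγA hsI)).hasFDerivAt.comp_hasDerivAt s hcs)
  have h2 := sub_localHamiltonian_le_lagrangian hcont hsuper hy v (fderiv ℝ ψ (c s))
  have h3 := hsub _ (hγA hsI)
  have h4 := mul_le_mul_of_nonneg_left (show lam * ψ (c s) +
    fderiv ℝ ψ (c s) (toModel x₀ (γ s) v) ≤ lagrangian H (γ s) v by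
      simp only [hc, Function.comp_apply] at h2 ⊢
      linarith) (Real.exp_pos (lam * s)).le
  rw [hgd.deriv, discountedIntegrand]
  linarith

omit [Bundle.RiemannianBundle (fun x : M => TangentSpace (𝓡 m) x)]
  [IsContinuousRiemannianBundle (EuclideanSpace ℝ (Fin m)) (fun x : M => TangentSpace (𝓡 m) x)] in
/-- If the supersolution inequality fails for `w` at `x₀`, then some classical subsolution near `x₀`
is above `w` at `x₀`, and below `w` on a small sphere around `x₀`. -/
lemma exists_classical_subsolution (hcont : IsContinuousHamiltonian H)
    {w : M → ℝ} {x₀ : M} {p : Cotangent (m := m) x₀} (hp : p ∈ subdifferential w x₀)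
    (hneg : lam * w x₀ + H x₀ p < 0) {s : Set M} (hs : s ∈ 𝓝 x₀) :
    ∃ (ψ : EuclideanSpace ℝ (Fin m) → ℝ) (r : ℝ) (κ : ℝ≥0), 0 < r ∧
      LipschitzOnWith κ ψ (Metric.closedBall (extChartAt (𝓡 m) x₀ x₀) r) ∧
      ψ (extChartAt (𝓡 m) x₀ x₀) = w x₀ + r ^ 2 ∧
      ∀ z ∈ Metric.closedBall (extChartAt (𝓡 m) x₀ x₀) r,
        z ∈ (extChartAt (𝓡 m) x₀).target ∧ (extChartAt (𝓡 m) x₀).symm z ∈ s ∧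
        DifferentiableAt ℝ ψ z ∧ lam * ψ z + localHamiltonian H x₀ z (fderiv ℝ ψ z) ≤ 0 ∧
        (r ≤ ‖z - extChartAt (𝓡 m) x₀ x₀‖ → ψ z ≤ w ((extChartAt (𝓡 m) x₀).symm z)) := by
  obtain ⟨ϕ, hϕ, hmin, hpϕ⟩ := exists_of_mem_subdifferential hp
  have hloc := localHamiltonian_extChartAt (H := H) (mem_extChartAt_source (I := 𝓡 m) x₀)
    (fderiv ℝ ϕ (extChartAt (𝓡 m) x₀ x₀))
  have hsymm : ContinuousAt (extChartAt (𝓡 m) x₀).symm (extChartAt (𝓡 m) x₀ x₀) :=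
    continuousAt_extChartAt_symm x₀
  have hs2 : (extChartAt (𝓡 m) x₀).symm ⁻¹' s ∈ 𝓝 (extChartAt (𝓡 m) x₀ x₀) := by
    rw [ContinuousAt, extChartAt_to_inv] at hsymm
    exact hsymm hs
  have hH : ContinuousOn (fun zq : EuclideanSpace ℝ (Fin m) × (EuclideanSpace ℝ (Fin m) →L[ℝ] ℝ) => localHamiltonian H x₀ zq.1 zq.2)
    ((extChartAt (𝓡 m) x₀).target ×ˢ univ) := continuousOn_localHamiltonian hcont x₀
  have htarget := extChartAt_target_mem_nhds (I := 𝓡 m) x₀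
  have hinv := extChartAt_to_inv (I := 𝓡 m) x₀
  rw [← hpϕ] at hloc
  generalize extChartAt (𝓡 m) x₀ x₀ = z₀ at *
  -- The quadratic term makes the contact with w strict without changing the differential at z₀.
  -- Raising ψ₀ by r² then keeps it below w where ‖z - z₀‖ ≥ r and lifts it above w at the centre.
  let ψ₀ : EuclideanSpace ℝ (Fin m) → ℝ := fun z => ϕ z - ϕ z₀ + w x₀ - ‖z - z₀‖ ^ 2
  have hψ₀ : ContDiffAt ℝ 1 ψ₀ z₀ :=
    ((hϕ.sub contDiffAt_const).add contDiffAt_const).sub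
      ((contDiffAt_id.sub contDiffAt_const).norm_sq ℝ)
  have hsq : HasFDerivAt (fun z : EuclideanSpace ℝ (Fin m) => ‖z - z₀‖ ^ 2) (0 : EuclideanSpace ℝ (Fin m) →L[ℝ] ℝ) z₀ := by
    have := ((hasFDerivAt_id (𝕜 := ℝ) z₀).sub_const z₀).norm_sq
    simpa using this
  have hψ₀d : fderiv ℝ ψ₀ z₀ = fderiv ℝ ϕ z₀ := by
    have := (((hϕ.differentiableAt one_ne_zero).hasFDerivAt.sub_const (ϕ z₀)).add_const
      (w x₀)).sub hsq
    rw [sub_zero] at this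
    exact this.fderiv
  let F : EuclideanSpace ℝ (Fin m) → ℝ := fun z => lam * ψ₀ z + localHamiltonian H x₀ z (fderiv ℝ ψ₀ z)
  have hFc : ContinuousAt F z₀ := by
    refine (hψ₀.continuousAt.const_mul lam).add ?_
    refine ContinuousAt.comp (f := fun z => (z, fderiv ℝ ψ₀ z))
      (g := fun zq : EuclideanSpace ℝ (Fin m) × (EuclideanSpace ℝ (Fin m) →L[ℝ] ℝ) => localHamiltonian H x₀ zq.1 zq.2) ?_
      (continuousAt_id.prodMk (hψ₀.continuousAt_fderiv one_ne_zero))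
    exact hH.continuousAt (prod_mem_nhds htarget Filter.univ_mem)
  have hψz : ψ₀ z₀ = w x₀ := by simp [ψ₀]
  have hF0 : F z₀ = lam * w x₀ + H x₀ p := by
    simp only [F, hψ₀d, hψz, hloc]
  -- Half of the defect survives near z₀, and it absorbs the term λr² produced by the lift.
  set θ := -(F z₀) / 2 with hθ
  have hθ0 : 0 < θ := by rw [hθ, hF0]; linarith
  obtain ⟨κ', s', hs', hκ'⟩ := hψ₀.exists_lipschitzOnWith
  have hFev : ∀ᶠ z in 𝓝 z₀, F z < -θ :=
    hFc.eventually_lt continuousAt_const (by rw [hθ]; linarith)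
  obtain ⟨r₁, hr₁, hball₁⟩ := Metric.mem_nhds_iff.1 (Filter.inter_mem (Filter.inter_mem
    (Filter.inter_mem hs' hs2) htarget)
      ((hFev.and (hψ₀.eventually (by simp))).and hmin))
  obtain ⟨r, hr, hrr₁, hrθ⟩ : ∃ r : ℝ, 0 < r ∧ r < r₁ ∧ lam * r ^ 2 ≤ θ := by
    have h1 : ∀ᶠ r : ℝ in 𝓝[>] 0, r < r₁ :=
      nhdsWithin_le_nhds (eventually_lt_nhds hr₁)
    have h2 : ∀ᶠ r : ℝ in 𝓝[>] 0, lam * r ^ 2 < θ := by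
      have h3 : ContinuousAt (fun r : ℝ => lam * r ^ 2) 0 := by fun_prop
      exact nhdsWithin_le_nhds (h3.eventually_lt continuousAt_const (by simpa using hθ0))
    obtain ⟨r, ⟨h3, h4⟩, h5⟩ := ((h1.and h2).and self_mem_nhdsWithin).exists
    exact ⟨r, h5, h3, h4.le⟩
  have hball : Metric.closedBall z₀ r ⊆ _ := (Metric.closedBall_subset_ball hrr₁).trans hball₁
  refine ⟨fun z => ψ₀ z + r ^ 2, r, κ', hr, ?_, by simp only [hψz], fun z hz => ?_⟩
  · intro z hz z' hz'
    simpa using hκ' (hball hz).1.1.1 (hball hz').1.1.1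
  · obtain ⟨⟨⟨-, h2⟩, h3⟩, ⟨h4, h5⟩, h6⟩ := hball hz
    refine ⟨h3, h2, (h5.differentiableAt one_ne_zero).add_const _, ?_, fun h7 => ?_⟩
    · simp only [F] at h4
      rw [fderiv_add_const]
      linarith
    · have h8 := pow_le_pow_left₀ hr.le h7 2
      simp only [hinv] at h6
      simp only [ψ₀]
      linarith

lemma exists_exp_neg_mul_le {lam : ℝ} (hlam : 0 < lam) (B : ℝ) {ε : ℝ} (hε : 0 < ε) :
    ∃ T : ℝ, 0 ≤ T ∧ Real.exp (-(lam * T)) * B ≤ ε := by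
  have h1 : Filter.Tendsto (fun T : ℝ => Real.exp (-(lam * T)) * B) Filter.atTop (𝓝 0) := by
    have h2 : Filter.Tendsto (fun T : ℝ => Real.exp (-(lam * T))) Filter.atTop (𝓝 0) :=
      Real.tendsto_exp_neg_atTop_nhds_zero.comp (Filter.tendsto_id.const_mul_atTop hlam)
    simpa using h2.mul_const B
  obtain ⟨T, h2, h3⟩ := ((h1.eventually (eventually_le_nhds hε)).and
    (Filter.eventually_ge_atTop 0)).exists
  exact ⟨T, h3, h2⟩

variable [IsRiemannianManifold (𝓡 m) M]

/-- The discounted value function is a viscosity supersolution. -/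
lemma isViscositySupersolution_discountedValue
    (hC : ∀ (x : M) (v : TangentSpace (𝓡 m) x), -C ≤ lagrangian H x v) (hlam : 0 < lam)
    (hcont : IsContinuousHamiltonian H) (hsuper : IsSuperlinearHamiltonian H) :
    IsViscositySupersolution (discountedOperator H lam)
      fun x : M => (discountedValue H lam x).toReal := by
  have hUcont := continuous_toReal_discountedValue hC hlam hcont hsuper
  refine ⟨hUcont, fun x₀ p hp => ?_⟩
  rw [discountedOperator]
  by_contra! hneg
  have hdpp := fun {γ : ℝ → M} (hγ : IsAbsolutelyContinuousCurve γ (Iic 0)) {t : ℝ} (ht : 0 ≤ t)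
    {a : ℝ} (h : (a : EReal) ≤ _) => le_discountedAction hC hlam hγ ht h
  have hreal := coe_toReal_discountedValue hC hlam x₀
  obtain ⟨κ, s, hs, hκ⟩ := exists_lipschitzOnWith_extChartAt (m := m) x₀
  obtain ⟨ψ, r, κ', hr, hκ', hψx, hψ⟩ :=
    exists_classical_subsolution hcont hp hneg hs
  beta_reduce at hψx hψ
  generalize hU : (fun x : M => (discountedValue H lam x).toReal) = U at *
  set z₀ := extChartAt (𝓡 m) x₀ x₀ with hz₀
  set A := (extChartAt (𝓡 m) x₀).symm '' Metric.closedBall z₀ r with hA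
  set G := (extChartAt (𝓡 m) x₀).source ∩ extChartAt (𝓡 m) x₀ ⁻¹' Metric.ball z₀ r with hG
  have hAφ : ∀ y ∈ A, extChartAt (𝓡 m) x₀ y ∈ Metric.closedBall z₀ r := by
    rintro _ ⟨z, hz, rfl⟩
    rwa [(extChartAt (𝓡 m) x₀).right_inv (hψ z hz).1]
  have hAsource : A ⊆ (extChartAt (𝓡 m) x₀).source := by
    rintro _ ⟨z, hz, rfl⟩
    exact (extChartAt (𝓡 m) x₀).map_target (hψ z hz).1
  have hAcpt : IsCompact A := (isCompact_closedBall z₀ r).image_of_continuousOn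
    ((continuousOn_extChartAt_symm x₀).mono fun z hz => (hψ z hz).1)
  have hAs : A ⊆ s := by
    rintro _ ⟨z, hz, rfl⟩
    exact (hψ z hz).2.1
  have hGA : G ⊆ A := fun y hy => ⟨extChartAt (𝓡 m) x₀ y, Metric.ball_subset_closedBall hy.2,
    (extChartAt (𝓡 m) x₀).left_inv hy.1⟩
  have hGopen : IsOpen G := (continuousOn_extChartAt x₀).isOpen_inter_preimage
    (isOpen_extChartAt_source x₀) Metric.isOpen_ball
  obtain ⟨B, hB⟩ := hAcpt.exists_bound_of_continuousOn
    (f := fun y => ψ (extChartAt (𝓡 m) x₀ y) - U y) (by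
      refine ContinuousOn.sub (ContinuousOn.comp (t := Metric.closedBall z₀ r) (g := ψ)
        hκ'.continuousOn ((continuousOn_extChartAt x₀).mono hAsource) hAφ) hUcont.continuousOn)
  -- A curve may never leave the ball; at the horizon T the discount makes ψ - u worth at most r²/2,
  -- half of the gain r² at the centre.
  obtain ⟨T, hT, hTB⟩ := exists_exp_neg_mul_le hlam B (ε := r ^ 2 / 2) (by positivity)
  have key : ((U x₀ + r ^ 2 / 2 : ℝ) : EReal) ≤ discountedValue H lam x₀ := by
    refine le_iInf₂ fun γ hγ => ?_
    obtain ⟨hγac, hγ0⟩ := hγ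
    have hγc := hγac.continuousOn_Icc hT
    obtain ⟨τ, ⟨hτ0, hτT⟩, hτA, hτ⟩ := exists_exit_time hT hγc hAcpt.isClosed hGopen hGA
      (show γ 0 ∈ G by
        rw [hγ0]
        exact ⟨mem_extChartAt_source x₀, Metric.mem_ball_self hr⟩)
    have h1 := sub_le_extendedIntegral (lam := lam) hcont hsuper hAsource (hκ.mono hAs)
      (hκ'.mono (by rintro _ ⟨y, hy, rfl⟩; exact hAφ y hy))
      (fun y hy => (hψ _ (hAφ y hy)).2.2.1) (fun y hy => (hψ _ (hAφ y hy)).2.2.2.1)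
      hγac hτ0 hτA
    have h2 := hdpp hγac hτ0 h1
    refine le_trans (EReal.coe_le_coe_iff.2 ?_) h2
    have hmemA : γ (-τ) ∈ A := hτA ⟨le_rfl, by linarith⟩
    -- Either the horizon T is reached and the discount does the work, or the curve is on the
    -- boundary of the ball, where ψ ≤ u.
    have h4 : Real.exp (-(lam * τ)) * (ψ (extChartAt (𝓡 m) x₀ (γ (-τ))) - U (γ (-τ))) ≤
        r ^ 2 / 2 := by
      rcases hτ with rfl | hτ
      · exact (mul_le_mul_of_nonneg_left ((le_abs_self _).trans (hB _ hmemA))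
          (Real.exp_pos _).le).trans hTB
      · have h5 : r ≤ ‖extChartAt (𝓡 m) x₀ (γ (-τ)) - z₀‖ := by
          by_contra! h
          exact hτ ⟨hAsource hmemA, by simpa only [mem_preimage, Metric.mem_ball, dist_eq_norm] using h⟩
        have h6 := (hψ _ (hAφ _ hmemA)).2.2.2.2 h5
        rw [(extChartAt (𝓡 m) x₀).left_inv (hAsource hmemA)] at h6
        subst hU
        have := mul_nonneg (Real.exp_pos (-(lam * τ))).le (sub_nonneg.2 h6)
        nlinarith [sq_nonneg r]
    subst hU
    rw [hγ0, hψx]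
    beta_reduce at h4 ⊢
    linarith
  subst hU
  rw [← hreal, EReal.coe_le_coe_iff] at key
  linarith [pow_pos hr 2]

end Supersolution
end DiscountedHJ

namespace DiscountedHJ

/-! ### Doubling of variables in a normed space. -/

section Doubling

variable {E : Type*} [NormedAddCommGroup E]

/-- Doubling of variables around a maximum point of `f - g`. -/
lemma exists_doubling_seq [ProperSpace E] {f g : E → ℝ} {z₀ : E} {r : ℝ} (hr : 0 < r)
    (hf : ContinuousOn f (Metric.closedBall z₀ r)) (hg : ContinuousOn g (Metric.closedBall z₀ r))
    (hmax : ∀ z ∈ Metric.closedBall z₀ r, f z - g z ≤ f z₀ - g z₀) :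
    ∃ a b : ℕ → E, Filter.Tendsto a Filter.atTop (𝓝 z₀) ∧ Filter.Tendsto b Filter.atTop (𝓝 z₀) ∧
      ∀ᶠ n : ℕ in Filter.atTop,
        IsLocalMax (fun z => f z - (n * ‖z - b n‖ ^ 2 + ‖z - z₀‖ ^ 2)) (a n) ∧
        IsLocalMin (fun z => g z - -(n * ‖a n - z‖ ^ 2)) (b n) := by
  set K := Metric.closedBall z₀ r with hK
  have hKc : IsCompact K := isCompact_closedBall z₀ r
  have hz₀ : z₀ ∈ K := Metric.mem_closedBall_self hr.le
  have hf1 : ContinuousOn (fun p : E × E => f p.1) (K ×ˢ K) :=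
    hf.comp continuousOn_fst fun p hp => hp.1
  have hg1 : ContinuousOn (fun p : E × E => g p.2) (K ×ˢ K) :=
    hg.comp continuousOn_snd fun p hp => hp.2
  -- The factor n pulls the two points together. The extra term ‖p.1 - z₀‖² makes them converge to
  -- z₀ itself, with no subsequence.
  have hex : ∀ n : ℕ, ∃ p ∈ K ×ˢ K, IsMaxOn
      (fun p : E × E => f p.1 - g p.2 - (n * ‖p.1 - p.2‖ ^ 2 + ‖p.1 - z₀‖ ^ 2)) (K ×ˢ K) p :=
    fun n => (hKc.prod hKc).exists_isMaxOn ⟨(z₀, z₀), hz₀, hz₀⟩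
      ((hf1.sub hg1).sub (by fun_prop))
  choose p hpK hp using hex
  obtain ⟨B, hB⟩ := (hKc.prod hKc).exists_bound_of_continuousOn (hf1.sub hg1)
  have hbase : ∀ n : ℕ, f z₀ - g z₀ ≤
      f (p n).1 - g (p n).2 - (n * ‖(p n).1 - (p n).2‖ ^ 2 + ‖(p n).1 - z₀‖ ^ 2) := fun n => by
    have := hp n (show (z₀, z₀) ∈ K ×ˢ K from ⟨hz₀, hz₀⟩)
    simpa using this
  have hdist : Filter.Tendsto (fun n => ‖(p n).1 - (p n).2‖ ^ 2) Filter.atTop (𝓝 0) := by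
    have h1 : Filter.Tendsto (fun n : ℕ => (B - (f z₀ - g z₀)) / n) Filter.atTop (𝓝 0) :=
      tendsto_const_div_atTop_nhds_zero_nat _
    refine tendsto_of_tendsto_of_tendsto_of_le_of_le' tendsto_const_nhds h1
      (Filter.Eventually.of_forall fun n => sq_nonneg _) ?_
    filter_upwards [Filter.eventually_gt_atTop 0] with n hn
    have hn' : (0 : ℝ) < n := by exact_mod_cast hn
    rw [le_div_iff₀ hn']
    have h2 := hbase n
    have h3 : f (p n).1 - g (p n).2 ≤ B := (le_abs_self _).trans (hB _ (hpK n))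
    nlinarith [sq_nonneg ‖(p n).1 - z₀‖]
  have hdist' : Filter.Tendsto (fun n => dist (p n).1 (p n).2) Filter.atTop (𝓝 0) := by
    have := hdist.sqrt
    simpa [dist_eq_norm, Real.sqrt_sq] using this
  have hgu := hKc.uniformContinuousOn_of_continuous hg
  have hgd : Filter.Tendsto (fun n => g (p n).1 - g (p n).2) Filter.atTop (𝓝 0) := by
    rw [Metric.tendsto_atTop]
    intro ε hε
    obtain ⟨δ, hδ, h⟩ := Metric.uniformContinuousOn_iff.1 hgu ε hε
    obtain ⟨N, hN⟩ := Metric.tendsto_atTop.1 hdist' δ hδ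
    refine ⟨N, fun n hn => ?_⟩
    have h1 := hN n hn
    rw [Real.dist_0_eq_abs, abs_of_nonneg dist_nonneg] at h1
    have h2 := h _ (hpK n).1 _ (hpK n).2 h1
    rwa [Real.dist_0_eq_abs, ← Real.dist_eq]
  have ha : Filter.Tendsto (fun n => (p n).1) Filter.atTop (𝓝 z₀) := by
    rw [tendsto_iff_dist_tendsto_zero]
    -- Comparing the penalised maximum with the maximality of z₀ for f - g leaves ‖a - z₀‖² ≤ g(a) -
    -- g(b), which tends to 0 by uniform continuity.
    have h1 : Filter.Tendsto (fun n => ‖(p n).1 - z₀‖ ^ 2) Filter.atTop (𝓝 0) := by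
      refine squeeze_zero (fun n => sq_nonneg _) (fun n => ?_) hgd
      have h2 := hbase n
      have h3 := hmax _ (hpK n).1
      have h4 : 0 ≤ (n : ℝ) * ‖(p n).1 - (p n).2‖ ^ 2 := by positivity
      linarith
    have := h1.sqrt
    simpa [dist_eq_norm, Real.sqrt_sq] using this
  have hb : Filter.Tendsto (fun n => (p n).2) Filter.atTop (𝓝 z₀) := by
    rw [tendsto_iff_dist_tendsto_zero] at ha ⊢
    refine squeeze_zero (fun n => dist_nonneg) (fun n => dist_triangle_left _ _ (p n).1) ?_
    simpa using hdist'.add ha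
  refine ⟨fun n => (p n).1, fun n => (p n).2, ha, hb, ?_⟩
  filter_upwards [ha (Metric.ball_mem_nhds z₀ hr), hb (Metric.ball_mem_nhds z₀ hr)] with n h1 h2
  constructor
  · filter_upwards [Metric.isOpen_ball.mem_nhds h1] with z hz
    have := hp n (show (z, (p n).2) ∈ K ×ˢ K from ⟨Metric.ball_subset_closedBall hz, (hpK n).2⟩)
    simp only [mem_ofPred_eq] at this
    linarith
  · filter_upwards [Metric.isOpen_ball.mem_nhds h2] with z hz
    have := hp n (show ((p n).1, z) ∈ K ×ˢ K from ⟨(hpK n).1, Metric.ball_subset_closedBall hz⟩)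
    simp only [mem_ofPred_eq] at this
    linarith

variable [InnerProductSpace ℝ E]

lemma contDiff_const_mul_norm_sub_sq (c : ℝ) (b : E) :
    ContDiff ℝ 1 fun z : E => c * ‖z - b‖ ^ 2 :=
  contDiff_const.mul ((contDiff_id.sub contDiff_const).norm_sq ℝ)

lemma hasFDerivAt_const_mul_norm_sub_sq (c : ℝ) (b a : E) :
    HasFDerivAt (fun z => c * ‖z - b‖ ^ 2) ((2 * c) • innerSL ℝ (a - b)) a := by
  have h := (((hasFDerivAt_id (𝕜 := ℝ) a).sub_const b).norm_sq).const_mul c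
  have h2 : (2 * c) • innerSL ℝ (a - b) =
      c • 2 • (innerSL ℝ (id a - b)) ∘L ContinuousLinearMap.id ℝ E := by
    rw [ContinuousLinearMap.comp_id, mul_comm, mul_smul, ofNat_smul_eq_nsmul]
    rfl
  rw [h2]
  exact h

end Doubling

/-! ### The comparison principle. -/

section Comparison

variable {m : ℕ} {M : Type*} [MetricSpace M] [CompactSpace M] [ChartedSpace (EuclideanSpace ℝ (Fin m)) M]
  [IsManifold (𝓡 m) ∞ M]
  {H : ∀ x : M, Cotangent (m := m) x → ℝ} {lam : ℝ}
  [Bundle.RiemannianBundle (fun x : M => TangentSpace (𝓡 m) x)]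
  [IsContinuousRiemannianBundle (EuclideanSpace ℝ (Fin m)) (fun x : M => TangentSpace (𝓡 m) x)]

/-- Comparison principle for the discounted equation. -/
lemma IsViscositySubsolution.le_supersolution {u w : M → ℝ}
    (hu : IsViscositySubsolution (discountedOperator H lam) u)
    (hw : IsViscositySupersolution (discountedOperator H lam) w) (hlam : 0 < lam)
    (hcont : IsContinuousHamiltonian H) (hsuper : IsSuperlinearHamiltonian H) (x : M) :
    u x ≤ w x := by
  obtain ⟨x₀, -, hx₀⟩ := isCompact_univ.exists_isMaxOn ⟨x, mem_univ x⟩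
    (hu.1.sub hw.1).continuousOn
  by_contra! hlt
  have hpos : 0 < u x₀ - w x₀ := (sub_pos.2 hlt).trans_le (hx₀ (mem_univ x))
  have hH : ContinuousOn (fun zq : EuclideanSpace ℝ (Fin m) × (EuclideanSpace ℝ (Fin m) →L[ℝ] ℝ) => localHamiltonian H x₀ zq.1 zq.2)
    ((extChartAt (𝓡 m) x₀).target ×ˢ univ) := continuousOn_localHamiltonian hcont x₀
  have htarget := extChartAt_target_mem_nhds (I := 𝓡 m) x₀
  have hinv := extChartAt_to_inv (I := 𝓡 m) x₀
  obtain ⟨R, hR, hsup⟩ := hsuper.localHamiltonian x₀ 1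
  generalize extChartAt (𝓡 m) x₀ x₀ = z₀ at *
  obtain ⟨r, hr, hball⟩ := Metric.nhds_basis_closedBall.mem_iff.1
    (Filter.inter_mem htarget hsup)
  set f : EuclideanSpace ℝ (Fin m) → ℝ := fun z => u ((extChartAt (𝓡 m) x₀).symm z) with hf
  set g : EuclideanSpace ℝ (Fin m) → ℝ := fun z => w ((extChartAt (𝓡 m) x₀).symm z) with hg
  have hsymm : ContinuousOn (extChartAt (𝓡 m) x₀).symm (Metric.closedBall z₀ r) :=
    (continuousOn_extChartAt_symm x₀).mono fun z hz => (hball hz).1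
  have hfc : ContinuousOn f (Metric.closedBall z₀ r) := hu.1.comp_continuousOn hsymm
  have hgc : ContinuousOn g (Metric.closedBall z₀ r) := hw.1.comp_continuousOn hsymm
  obtain ⟨a, b, ha, hb, hab⟩ := exists_doubling_seq hr hfc hgc fun z hz => by
    simp only [hf, hg, hinv]
    exact hx₀ (mem_univ ((extChartAt (𝓡 m) x₀).symm z))
  have hnhds := Metric.closedBall_mem_nhds z₀ hr
  have hfz : Filter.Tendsto (fun n => f (a n)) Filter.atTop (𝓝 (f z₀)) :=
    (hfc.continuousAt hnhds).tendsto.comp ha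
  have hgz : Filter.Tendsto (fun n => g (b n)) Filter.atTop (𝓝 (g z₀)) :=
    (hgc.continuousAt hnhds).tendsto.comp hb
  -- The test functions have differentials q + e at a and q at b; e comes from the localising term
  -- and tends to 0.
  let e : ℕ → (EuclideanSpace ℝ (Fin m) →L[ℝ] ℝ) := fun n => (2 * (1 : ℝ)) • innerSL ℝ (a n - z₀)
  let q : ℕ → (EuclideanSpace ℝ (Fin m) →L[ℝ] ℝ) := fun n => (2 * (n : ℝ)) • innerSL ℝ (a n - b n)
  have he : Filter.Tendsto e Filter.atTop (𝓝 0) := by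
    have h1 : Continuous fun z : EuclideanSpace ℝ (Fin m) => (2 * (1 : ℝ)) • innerSL ℝ (z - z₀) := by fun_prop
    have h2 := (h1.tendsto z₀).comp ha
    rw [sub_self, map_zero, smul_zero] at h2
    exact h2
  have hsub : ∀ᶠ n in Filter.atTop, lam * f (a n) + localHamiltonian H x₀ (a n) (q n + e n) ≤ 0 ∧
      0 ≤ lam * g (b n) + localHamiltonian H x₀ (b n) (q n) := by
    filter_upwards [hab, ha hnhds, hb hnhds] with n ⟨h1, h2⟩ h3 h4
    have hca : ContDiff ℝ 1 fun z => (n : ℝ) * ‖z - b n‖ ^ 2 + ‖z - z₀‖ ^ 2 := by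
      simpa only [one_mul] using (contDiff_const_mul_norm_sub_sq (n : ℝ) (b n)).add
        (contDiff_const_mul_norm_sub_sq 1 z₀)
    have hcb : ContDiff ℝ 1 fun z => -((n : ℝ) * ‖a n - z‖ ^ 2) := by
      simpa only [norm_sub_rev (a n)] using (contDiff_const_mul_norm_sub_sq (n : ℝ) (a n)).neg
    have hda : HasFDerivAt (fun z => (n : ℝ) * ‖z - b n‖ ^ 2 + ‖z - z₀‖ ^ 2) (q n + e n) (a n) := by
      have h5 := (hasFDerivAt_const_mul_norm_sub_sq (n : ℝ) (b n) (a n)).add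
        (hasFDerivAt_const_mul_norm_sub_sq 1 z₀ (a n))
      simp only [one_mul] at h5
      exact h5
    have hdb : HasFDerivAt (fun z => -((n : ℝ) * ‖a n - z‖ ^ 2)) (q n) (b n) := by
      have h5 := (hasFDerivAt_const_mul_norm_sub_sq (n : ℝ) (a n) (b n)).neg
      rw [← smul_neg, ← map_neg, neg_sub] at h5
      simp only [norm_sub_rev (a n)]
      exact h5
    constructor
    · have h5 := hu.2 _ _ (fderiv_comp_toModel_mem_superdifferential (hball h3).1
        hca.contDiffAt h1)
      have h6 := localHamiltonian_extChartAt (H := H)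
        ((extChartAt (𝓡 m) x₀).map_target (hball h3).1) (q n + e n)
      rw [(extChartAt (𝓡 m) x₀).right_inv (hball h3).1] at h6
      rw [hda.fderiv, discountedOperator, ← h6] at h5
      exact h5
    · have h5 := hw.2 _ _ (fderiv_comp_toModel_mem_subdifferential (hball h4).1
        hcb.contDiffAt h2)
      have h6 := localHamiltonian_extChartAt (H := H)
        ((extChartAt (𝓡 m) x₀).map_target (hball h4).1) (q n)
      rw [(extChartAt (𝓡 m) x₀).right_inv (hball h4).1] at h6
      rw [hdb.fderiv, discountedOperator, ← h6] at h5
      exact h5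
  -- The factor n in q is harmless: the subsolution inequality bounds H(a, q + e) above, while H
  -- dominates the norm of covectors beyond R.
  have hbdd : ∀ᶠ n in Filter.atTop,
      q n + e n ∈ Metric.closedBall (0 : EuclideanSpace ℝ (Fin m) →L[ℝ] ℝ) (max R (-(lam * f z₀) + 1)) := by
    have h1 : ∀ᶠ n in Filter.atTop, -(lam * f (a n)) < -(lam * f z₀) + 1 :=
      (hfz.const_mul lam).neg.eventually_lt_const (by linarith)
    filter_upwards [hsub, ha hnhds, h1] with n h2 h3 h4
    rw [mem_closedBall_zero_iff]
    rcases le_total R ‖q n + e n‖ with h5 | h5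
    · have h6 := (hball h3).2 _ h5
      exact le_max_of_le_right (by linarith [h2.1])
    · exact le_max_of_le_left h5
  obtain ⟨p, -, σ, hσ, hp⟩ := (isCompact_closedBall _ _).tendsto_subseq' hbdd.frequently
  have hσ' := hσ.tendsto_atTop
  have hq : Filter.Tendsto (q ∘ σ) Filter.atTop (𝓝 p) := by
    have := hp.sub (he.comp hσ')
    simpa [Function.comp_def] using this
  have hHc := hH.continuousAt (x := (z₀, p)) (prod_mem_nhds htarget Filter.univ_mem)
  have hlim1 := ((hfz.comp hσ').const_mul lam).add
    (hHc.tendsto.comp ((ha.comp hσ').prodMk_nhds hp))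
  have hlim2 := ((hgz.comp hσ').const_mul lam).add
    (hHc.tendsto.comp ((hb.comp hσ').prodMk_nhds hq))
  have h1 := le_of_tendsto hlim1 ((hσ'.eventually hsub).mono fun n hn => hn.1)
  have h2 := ge_of_tendsto hlim2 ((hσ'.eventually hsub).mono fun n hn => hn.2)
  simp only [hf, hg, hinv] at h1 h2
  -- Both limits contain the same H(z₀, p); subtracting them gives λ(u - w)(x₀) ≤ 0, against `hpos`.
  nlinarith

end Comparison

end DiscountedHJ

/-! ### Conclusion: existence and uniqueness. -/

theorem mainTheorem10 {m : ℕ} {M : Type*} [MetricSpace M] [CompactSpace M] [ConnectedSpace M]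
    [ChartedSpace (EuclideanSpace ℝ (Fin m)) M] [IsManifold (𝓡 m) ∞ M]
    [Bundle.RiemannianBundle (fun x : M => TangentSpace (𝓡 m) x)]
    [IsContMDiffRiemannianBundle (𝓡 m) ∞ (EuclideanSpace ℝ (Fin m))
      (fun x : M => TangentSpace (𝓡 m) x)]
    [IsRiemannianManifold (𝓡 m) M]
    (H : ∀ x : M, DiscountedHJ.Cotangent (m := m) x → ℝ)
    (hcont : DiscountedHJ.IsContinuousHamiltonian H)
    (hconv : DiscountedHJ.IsConvexHamiltonian H)
    (hsuper : DiscountedHJ.IsSuperlinearHamiltonian H)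
    (lam : ℝ) (hlam : 0 < lam) :
    ∃ u : M → ℝ,
      (∀ x : M, DiscountedHJ.discountedValue H lam x = (u x : EReal)) ∧
      Continuous u ∧
      DiscountedHJ.IsViscositySolution (DiscountedHJ.discountedOperator H lam) u ∧
      ∀ w : M → ℝ, Continuous w →
        DiscountedHJ.IsViscositySolution (DiscountedHJ.discountedOperator H lam) w →
        w = u := by
  have : IsContinuousRiemannianBundle (EuclideanSpace ℝ (Fin m))
      (fun x : M => TangentSpace (𝓡 m) x) := by
    obtain ⟨g, hg, hgi⟩ := IsContMDiffRiemannianBundle.exists_contMDiff (IB := 𝓡 m) (n := ∞)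
      (F := EuclideanSpace ℝ (Fin m)) (E := fun x : M => TangentSpace (𝓡 m) x)
    exact ⟨g, hg.continuous, hgi⟩
  obtain ⟨C, hC⟩ := DiscountedHJ.exists_le_lagrangian hcont hsuper
  have hsub := DiscountedHJ.isViscositySubsolution_discountedValue hC hlam hcont hconv hsuper
  have hsup := DiscountedHJ.isViscositySupersolution_discountedValue hC hlam hcont hsuper
  refine ⟨fun x => (DiscountedHJ.discountedValue H lam x).toReal,
    fun x => (DiscountedHJ.coe_toReal_discountedValue hC hlam x).symm, hsub.1, ⟨hsub, hsup⟩,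
    fun w _ hw => funext fun x => le_antisymm ?_ ?_⟩
  · exact hw.1.le_supersolution hsup hlam hcont hsuper x
  · exact hsub.le_supersolution hw.2 hlam hcont hsuper x
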